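/- Let $\mathbb N=\{1,2,3,\dots\}$. Let $Y$ be one of the sequence spaces $\ell^p$ ($1\le p<\infty$), $c_0$ (complex, with their usual norms), or $$s=\Bigl\{x\in\mathbb C^{\mathbb N}:\ \|x\|_k=\sum_{n}|x_n|n^k<\infty\ \text{for all }k\Bigr\}$$ with the topology of the norms $\|\cdot\|_k$. Let $X_Y=\bigoplus_{i\in\mathbb N}Y$ be the locally convex direct sum (finest locally convex topology making all inclusions of summands continuous), and let $(e_{i,j})_j$ be the canonical unit vectors of the $i$-th summand. Identify $Y$ with the first summand, carrying its own topology. There is a bijection $f:(\mathbb N\times\mathbb N)\setminus\{(1,1)\}\to\mathbb N\times\mathbb N$ such that for every $\lambda>1$ and each of the above spaces $Y$, with $X=X_Y$, the following hold. 1. (Snake shift.) There is a continuous linear operator $T:X\to X$ with $Te_{1,1}=0$ and $Te_{i,j}=\lambda e_{f(i,j)}$ for $(i,j)\ne(1,1)$. Let $S$ be the linear map on the span of the $e_{i,j}$ (the vectors of finite support) given by $Se_{i,j}=\lambda^{-1}e_{f^{-1}(i,j)}$, and put $S_n=S^n$. 2. There are vectors $x_k\in X$ ($k\in\mathbb N$)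 of finite support, scalars $(\alpha_j)_{j\in\mathbb N}\subset\mathbb C$ and strictly increasing sequences $(m_k)_{k\ge1}$, $(n_k)_{k\ge1}$ in $\mathbb N$ and $(l_k)_{k\ge0}$ with $l_0=0$, such that, for all $k$, $m_k\le n_k$, $|\alpha_j|\le k$ for $m_k\le j\le n_k$, and $$T^{l_k}\Bigl(\sum_{j=m_k}^{n_k}\frac{1}{\lambda^{l_k}}\alpha_je_{1,j}\Bigr)=x_k,\qquad S_{l_k}x_k=\sum_{j=m_k}^{n_k}\frac1{\lambda^{l_k}}\alpha_je_{1,j};$$ moreover $T^{l_k}S_{l_j}x_i=0$ and $T^{l_j}S_{l_k}x_i\in Y$ whenever $i,j,k\in\mathbb N$ and $k>j+i$. 3. With $X_0=\{x_k:k\in\mathbb N\}$, these data satisfy the conditions of the hypercyclicity criterion: every point of $X$ is the limit of a sequence in $X_0$ (so $X$ is sequentially separable); $Y$ is an F-space (complete metrizable topological vector space) whose topology is finer than the one induced by $X$; and for every $x\in X_0$ * (i)' for all $j\ge1$, $(T^{l_k}S_{l_j}x)_k$ is eventually contained in $Y$ and converges to $0$ in $Y$; * (ii)' for all $j\ge0$,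 $(T^{l_j}S_{l_k}x)_k$ is eventually contained in $Y$ and converges to $0$ in $Y$; * (iii)' $(x-T^{l_k}S_{l_k}x)_k$ is eventually contained in $Y$ and converges to $0$ in $Y$. 4. $T$ is sequentially hypercyclic: there is $x\in X$ such that for each $y\in X$ there is a strictly increasing sequence of integers $(r_k)_k$ with $\lim_kT^{r_k}x=y$. -/

import Mathlib

open Filter Topology
open scoped ENNReal ZeroAtInfty DirectSum

noncomputable section

/-! ### Sequential hypercyclicity and F-spaces -/

section General

variable {X : Type*} [AddCommGroup X] [Module ℂ X] [TopologicalSpace X]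

/-- `T` is sequentially hypercyclic: some `x` is such that every `y` is a limit
`lim_k T^{n_k} x` along some strictly increasing sequence of integers `(n_k)`. -/
def IsSequentiallyHypercyclic (T : X →L[ℂ] X) : Prop :=
  ∃ x : X, ∀ y : X, ∃ n : ℕ → ℕ, StrictMono n ∧ Tendsto (fun k => (T ^ n k) x) atTop (𝓝 y)

/-- Every point of the space is the limit of a sequence in `A`. -/
def IsSequentiallyDense (A : Set X) : Prop :=
  ∀ z : X, ∃ u : ℕ → X, (∀ k, u k ∈ A) ∧ Tendsto u atTop (𝓝 z)

/-- An F-space: a complete metrizable topological vector space. -/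
structure IsFSpace (E : Type*) [AddCommGroup E] [Module ℂ E] [TopologicalSpace E] : Prop where
  isTopologicalAddGroup : IsTopologicalAddGroup E
  continuousSMul : ContinuousSMul ℂ E
  metrizable : TopologicalSpace.MetrizableSpace E
  complete : @CompleteSpace E (IsTopologicalAddGroup.rightUniformSpace E)

/-- The sequence `u` of `X` is eventually contained in the subspace `Y` and converges to `0`
in `(Y, τ)`. -/
def EventuallyInTendstoZero (Y : Submodule ℂ X) (τ : TopologicalSpace Y) (u : ℕ → X) : Prop :=
  ∃ v : ℕ → Y, (∀ᶠ k in atTop, (v k : X) = u k) ∧ Tendsto v atTop (@nhds Y τ 0)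

/-- The conditions of the criterion for sequential hypercyclicity of `T`, for the countable
sequentially dense set `X₀`, the maps `S n : X₀ → X`, the subspace `Y` with the finer F-space
topology `τ`, and the increasing sequence of integers `n` with `n 0 = 0`. -/
structure SatisfiesCriterion (T : X →L[ℂ] X) (X₀ : Set X) (S : ℕ → X₀ → X)
    (Y : Submodule ℂ X) (τ : TopologicalSpace Y) (n : ℕ → ℕ) : Prop where
  countable : X₀.Countable
  dense : IsSequentiallyDense X₀
  finer : τ ≤ instTopologicalSpaceSubtype
  isFSpace : @IsFSpace Y _ _ τ
  zero : n 0 = 0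
  strictMono : StrictMono n
  cond_i : ∀ x : X₀, ∀ j, 1 ≤ j →
    EventuallyInTendstoZero Y τ (fun k => (T ^ n k) (S (n j) x))
  cond_ii : ∀ x : X₀, ∀ j,
    EventuallyInTendstoZero Y τ (fun k => (T ^ n j) (S (n k) x))
  cond_iii : ∀ x : X₀,
    EventuallyInTendstoZero Y τ (fun k => (x : X) - (T ^ n k) (S (n k) x))

end General

/-! ### The countable locally convex direct sum of copies of `Y` -/

/-- The algebraic direct sum of copies of `Y`, indexed by the positive integers. -/
def LCDirectSum (Y : Type) [AddCommGroup Y] : Type := ⨁ _ : ℕ+, Y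

namespace LCDirectSum

variable (Y : Type) [AddCommGroup Y]

instance : AddCommGroup (LCDirectSum Y) := inferInstanceAs (AddCommGroup (⨁ _ : ℕ+, Y))

variable [Module ℂ Y]

instance : Module ℂ (LCDirectSum Y) := inferInstanceAs (Module ℂ (⨁ _ : ℕ+, Y))

/-- The inclusion of the `i`-th summand. -/
def incl (i : ℕ+) : Y →ₗ[ℂ] LCDirectSum Y := DirectSum.lof ℂ ℕ+ (fun _ => Y) i

variable [TopologicalSpace Y]

/-- The locally convex direct sum topology: the finest locally convex vector space topology for
which all the inclusions of the summands are continuous. -/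
instance : TopologicalSpace (LCDirectSum Y) :=
  sInf {t | (∀ i : ℕ+, @Continuous Y (LCDirectSum Y) _ t (incl Y i)) ∧
    @IsTopologicalAddGroup (LCDirectSum Y) t _ ∧
    @ContinuousSMul ℂ (LCDirectSum Y) _ _ t ∧
    @LocallyConvexSpace ℝ (LCDirectSum Y) _ _ _ _ t}

instance : IsTopologicalAddGroup (LCDirectSum Y) :=
  topologicalAddGroup_sInf fun _ ⟨_, ht, _, _⟩ => ht

instance : ContinuousSMul ℂ (LCDirectSum Y) :=
  continuousSMul_sInf fun _ ⟨_, _, ht, _⟩ => ht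

instance : LocallyConvexSpace ℝ (LCDirectSum Y) :=
  .sInf fun _ ⟨_, _, _, ht⟩ => ht

theorem continuous_incl (i : ℕ+) : Continuous (incl Y i) :=
  continuous_sInf_rng.2 fun _ ht => ht.1 i

/-- The first summand, as a subspace of the direct sum. -/
def firstSummand : Submodule ℂ (LCDirectSum Y) := LinearMap.range (incl Y 1)

/-- The topology of `Y`, transported to the first summand. -/
@[reducible] def firstSummandTopology : TopologicalSpace (firstSummand Y) :=
  TopologicalSpace.coinduced (incl Y 1).rangeRestrict inferInstance

end LCDirectSum

/-! ### The space `s` of rapidly decreasing sequences -/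

/-- The complex sequences `x` with `∑ |x_n| n^k < ∞` for all `k`, as a linear subspace. -/
def rapidlyDecreasingSubmodule : Submodule ℂ (ℕ+ → ℂ) where
  carrier := {x | ∀ k : ℕ, Summable fun n : ℕ+ => ‖x n‖ * (n : ℝ) ^ k}
  zero_mem' := fun k => by simp
  add_mem' := fun {x y} hx hy k => by
    refine Summable.of_nonneg_of_le (fun n => by positivity) (fun n => ?_) ((hx k).add (hy k))
    rw [← add_mul]
    exact mul_le_mul_of_nonneg_right (norm_add_le _ _) (by positivity)
  smul_mem' := fun c x hx k => by
    simpa [mul_assoc] using (hx k).mul_left ‖c‖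

/-- The space `s` of rapidly decreasing sequences. -/
def RapidlyDecreasing : Type := rapidlyDecreasingSubmodule

namespace RapidlyDecreasing

instance : AddCommGroup RapidlyDecreasing :=
  inferInstanceAs (AddCommGroup rapidlyDecreasingSubmodule)

instance : Module ℂ RapidlyDecreasing :=
  inferInstanceAs (Module ℂ rapidlyDecreasingSubmodule)

/-- The norms `‖x‖_k = ∑ |x_n| n^k`. -/
def seminorm (k : ℕ) : Seminorm ℂ RapidlyDecreasing :=
  Seminorm.of (fun x => ∑' n : ℕ+, ‖x.1 n‖ * (n : ℝ) ^ k)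
    (fun x y => by
      rw [← (x.2 k).tsum_add (y.2 k)]
      refine ((x + y).2 k).tsum_le_tsum (fun n => ?_) ((x.2 k).add (y.2 k))
      rw [← add_mul]
      exact mul_le_mul_of_nonneg_right (norm_add_le _ _) (by positivity))
    (fun c x => by
      rw [← tsum_mul_left]
      refine tsum_congr fun n => ?_
      rw [← mul_assoc, ← norm_mul]
      rfl)

/-- The Fréchet space topology of `s`, given by the norms `‖x‖_k`. -/
instance : TopologicalSpace RapidlyDecreasing :=
  (SeminormFamily.moduleFilterBasis seminorm).topology

theorem withSeminorms : WithSeminorms seminorm := ⟨rfl⟩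

/-- The canonical unit vectors of `s`. -/
def unit (j : ℕ+) : RapidlyDecreasing :=
  ⟨Pi.single j 1, fun k => summable_of_ne_finset_zero (s := {j}) fun n hn => by
    have h : n ≠ j := by simpa using hn
    simp [h]⟩

end RapidlyDecreasing

/-- The canonical unit vectors of `c₀`. -/
def c0Unit (j : ℕ+) : C₀(ℕ+, ℂ) where
  toFun := Pi.single j 1
  continuous_toFun := continuous_of_discreteTopology
  zero_at_infty' := by
    rw [cocompact_eq_cofinite]
    refine tendsto_nhds_of_eventually_eq ?_
    filter_upwards [(Set.finite_singleton j).compl_mem_cofinite] with n hn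
    have h : n ≠ j := by simpa using hn
    simp [h]

/-! ### The snake shift -/

section Snake

variable (Y : Type) [AddCommGroup Y] [Module ℂ Y]

/-- The unit vector `e_{i,j}` of the direct sum, `δ` being the sequence of canonical unit
vectors of `Y`. -/
def unitVec (δ : ℕ+ → Y) (q : ℕ+ × ℕ+) : LCDirectSum Y := LCDirectSum.incl Y q.1 (δ q.2)

/-- The vectors of finite support, i.e. the linear span of the `e_{i,j}`. -/
def finSupp (δ : ℕ+ → Y) : Submodule ℂ (LCDirectSum Y) :=
  Submodule.span ℂ (Set.range (unitVec Y δ))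

/-- The vector `e_{i,j}` as an element of the space of vectors of finite support. -/
def finUnitVec (δ : ℕ+ → Y) (q : ℕ+ × ℕ+) : finSupp Y δ :=
  ⟨unitVec Y δ q, Submodule.subset_span ⟨q, rfl⟩⟩

variable [TopologicalSpace Y]

/-- The assertions about the snake shift on the direct sum of copies of `Y` given by the
bijection `f` and the constant `lam`, where `δ` is the sequence of canonical unit vectors
of `Y`. -/
def SnakeShiftProperty (δ : ℕ+ → Y) (f : {q : ℕ+ × ℕ+ // q ≠ (1, 1)} ≃ ℕ+ × ℕ+)
    (lam : ℝ) : Prop :=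
  ∃ (T : LCDirectSum Y →L[ℂ] LCDirectSum Y) (S : finSupp Y δ →ₗ[ℂ] finSupp Y δ),
    -- the operators
    T (unitVec Y δ (1, 1)) = 0 ∧
    (∀ q : {q : ℕ+ × ℕ+ // q ≠ (1, 1)},
      T (unitVec Y δ q.1) = (lam : ℂ) • unitVec Y δ (f q)) ∧
    (∀ q : ℕ+ × ℕ+, S (finUnitVec Y δ q) = (lam : ℂ)⁻¹ • finUnitVec Y δ (f.symm q).1) ∧
    (∃ (x : ℕ+ → finSupp Y δ) (l : ℕ → ℕ) (m n : ℕ+ → ℕ+) (α : ℕ+ → ℂ),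
      -- the vectors `x_k` come from blocks in the first summand
      StrictMono m ∧ StrictMono n ∧
      (∀ k : ℕ+, m k ≤ n k) ∧
      (∀ k : ℕ+, ∀ j ∈ Finset.Icc (m k) (n k), ‖α j‖ ≤ (k : ℝ)) ∧
      (∀ k : ℕ+, (T ^ l k) (∑ j ∈ Finset.Icc (m k) (n k),
        ((lam : ℂ) ^ l k)⁻¹ • α j • unitVec Y δ (1, j)) = x k) ∧
      (∀ k : ℕ+, ((S ^ l k) (x k) : LCDirectSum Y) = ∑ j ∈ Finset.Icc (m k) (n k),
        ((lam : ℂ) ^ l k)⁻¹ • α j • unitVec Y δ (1, j)) ∧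
      (∀ i j k : ℕ+, j + i < k → (T ^ l k) ((S ^ l j) (x i) : LCDirectSum Y) = 0) ∧
      (∀ i j k : ℕ+, j + i < k →
        (T ^ l j) ((S ^ l k) (x i) : LCDirectSum Y) ∈ LCDirectSum.firstSummand Y) ∧
      -- the conditions of the criterion, with `X₀ = {x_k}` and `S_n = S^n`
      ∃ hX₀ : (Set.range fun k => (x k : LCDirectSum Y)) ⊆ finSupp Y δ,
        SatisfiesCriterion T (Set.range fun k => (x k : LCDirectSum Y))
          (fun r z => ((S ^ r) ⟨z.1, hX₀ z.2⟩ : LCDirectSum Y))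
          (LCDirectSum.firstSummand Y) (LCDirectSum.firstSummandTopology Y) l) ∧
    IsSequentiallyHypercyclic T

end Snake

end

noncomputable section

/-! ### The snake -/

namespace Snake

/-! The bijection comes from a path (the snake) that visits every position once, starting at (1,1).
T moves one step back along it and multiplies by λ, S moves one step forward and divides by λ. In
the time windows 16^K ≤ t < 4·16^K the row is a sawtooth, falling from 2s to 0 for s² ≤ t ≤ s² + 2s.
In the windows 4·16^K ≤ t < 16^(K+1) the path stays in the first row. The column is the number of
earlier visits to the current row.

Two features make T continuous. Going back in time raises the row by at most one (`row_le_succ`), so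
T sends each summand into finitely many summands. In a fixed row, time is at most quadratic in the
column (`le_mul_col_sq`), so each component of T is a polynomially bounded injective reindexing,
which is continuous on s; on ℓ^p and c₀ injectivity alone suffices.

The times l_k lie so deep inside first-row windows that block k, at times l_k, …, l_k + k, stays in
the first row even after T^(l_j) with j < k (`pos_time_fst`). The x_k run through all finitely
supported vectors with rational coefficients, each infinitely often, with size controlled by k.

Hypercyclicity is read off directly, not deduced from the criterion. For the vector ∑ S_(l_k) x_k
one has T^(l_k) ∑ S_(l_i) x_i = x_k + tail_k, where tail_k lies in the first row. Its coefficients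
have a geometric bound uniform in k and vanish up to time k, so tail_k → 0 already in s, hence in
every Y (`exists_tails`, `forward_pow_tail`). -/

open Classical in
/-- The zero-based row of the snake at time `t`. -/
def row (t : ℕ) : ℕ :=
  if ∃ K, 16 ^ K ≤ t ∧ t < 4 * 16 ^ K then (Nat.sqrt t + 1) ^ 2 - 1 - t else 0

/-- The zero-based column of the snake at time `t`: the number of earlier visits to its row. -/
def col (t : ℕ) : ℕ := Nat.count (fun s => row s = row t) t

theorem row_of_free {K t : ℕ} (h1 : 16 ^ K ≤ t) (h2 : t < 4 * 16 ^ K) :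
    row t = (Nat.sqrt t + 1) ^ 2 - 1 - t := if_pos ⟨K, h1, h2⟩

theorem row_eq_zero {K t : ℕ} (h1 : 4 * 16 ^ K ≤ t) (h2 : t < 16 ^ (K + 1)) : row t = 0 := by
  refine if_neg ?_
  rintro ⟨L, h3, h4⟩
  rcases le_or_gt L K with h | h
  · have := Nat.pow_le_pow_right (n := 16) (by norm_num) h
    omega
  · have := Nat.pow_le_pow_right (n := 16) (by norm_num) (Nat.succ_le_of_lt h)
    simp only [Nat.succ_eq_add_one] at this
    omega

theorem row_zero : row 0 = 0 := by
  refine if_neg ?_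
  rintro ⟨L, h3, -⟩
  have : 0 < 16 ^ L := by positivity
  omega

theorem sawtooth_le (t : ℕ) :
    (Nat.sqrt t + 1) ^ 2 - 1 - t ≤ (Nat.sqrt (t + 1) + 1) ^ 2 - 1 - (t + 1) + 1 := by
  have h1 : Nat.sqrt t ≤ Nat.sqrt (t + 1) := Nat.sqrt_le_sqrt (Nat.le_succ t)
  have h2 : (Nat.sqrt t + 1) ^ 2 ≤ (Nat.sqrt (t + 1) + 1) ^ 2 := by gcongr
  omega

/-- Inside a tooth the row drops by one per step; everywhere else it can only stay or jump up. This
confines the image of row i under T to the rows up to i + 1. -/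
theorem row_le_succ (t : ℕ) : row t ≤ row (t + 1) + 1 := by
  by_cases ht : ∃ K, 16 ^ K ≤ t ∧ t < 4 * 16 ^ K
  · obtain ⟨K, h1, h2⟩ := ht
    rw [row_of_free h1 h2]
    rcases lt_or_ge (t + 1) (4 * 16 ^ K) with h3 | h3
    · rw [row_of_free (h1.trans (Nat.le_succ t)) h3]
      exact sawtooth_le t
    -- The window closes at a perfect square, exactly when the last tooth has come down to row 0.
    · have h4 : t + 1 = (2 * 4 ^ K) * (2 * 4 ^ K) := by
        have : (16 : ℕ) ^ K = 4 ^ K * 4 ^ K := by rw [← mul_pow]; norm_num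
        have h5 : t + 1 = 4 * 16 ^ K := by omega
        rw [h5, this]; ring
      have h6 : Nat.sqrt t + 1 ≤ 2 * 4 ^ K := by
        have : Nat.sqrt t < 2 * 4 ^ K := Nat.sqrt_lt.2 (by omega)
        omega
      have h7 : (Nat.sqrt t + 1) ^ 2 ≤ t + 1 := by
        rw [h4, pow_two]; exact Nat.mul_le_mul h6 h6
      omega
  · rw [row, if_neg ht]; omega

/-- Tooth s lies entirely in window K and meets row i exactly i steps before its end. -/
theorem row_sq_sub {K s i : ℕ} (h1 : 4 ^ K ≤ s) (h2 : s < 2 * 4 ^ K) (hi : i ≤ 2 * s) :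
    row ((s + 1) ^ 2 - 1 - i) = i := by
  have e16 : (16 : ℕ) ^ K = 4 ^ K * 4 ^ K := by rw [← mul_pow]; norm_num
  have e1 : (s + 1) ^ 2 = s * s + 2 * s + 1 := by ring
  have hsq : Nat.sqrt ((s + 1) ^ 2 - 1 - i) = s := by
    refine (Nat.eq_sqrt.2 ?_).symm
    constructor
    · omega
    · have : (s + 1) * (s + 1) = s * s + 2 * s + 1 := by ring
      omega
  have h3 : 4 ^ K * 4 ^ K ≤ s * s := Nat.mul_le_mul h1 h1
  have h4 : (s + 1) * (s + 1) ≤ (2 * 4 ^ K) * (2 * 4 ^ K) := Nat.mul_le_mul h2 h2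
  have h5 : (2 * 4 ^ K) * (2 * 4 ^ K) = 4 * (4 ^ K * 4 ^ K) := by ring
  have h6 : (s + 1) * (s + 1) = s * s + 2 * s + 1 := by ring
  rw [row_of_free (K := K) (by omega) (by omega), hsq]
  omega

/-- Window K consists of 4^K teeth, each tall enough one visits row i, and at most i of them are too
short. -/
theorem le_count_row (K i : ℕ) : 4 ^ K ≤ Nat.count (fun s => row s = i) (4 * 16 ^ K) + i := by
  have e16 : (16 : ℕ) ^ K = 4 ^ K * 4 ^ K := by rw [← mul_pow]; norm_num
  have hcard : ((Finset.Ico (4 ^ K) (2 * 4 ^ K)).filter (fun s => i ≤ 2 * s)).card ≤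
      Nat.count (fun s => row s = i) (4 * 16 ^ K) := by
    rw [Nat.count_eq_card_filter_range]
    refine Finset.card_le_card_of_injOn (fun s => (s + 1) ^ 2 - 1 - i) ?_ ?_
    · intro s hs
      simp only [Finset.coe_filter, Finset.mem_Ico, Set.mem_ofPred_eq] at hs
      simp only [Finset.coe_filter, Finset.mem_range, Set.mem_ofPred_eq]
      refine ⟨?_, row_sq_sub hs.1.1 hs.1.2 hs.2⟩
      have h4 : (s + 1) * (s + 1) ≤ (2 * 4 ^ K) * (2 * 4 ^ K) := Nat.mul_le_mul hs.1.2 hs.1.2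
      have h5 : (2 * 4 ^ K) * (2 * 4 ^ K) = 4 * (4 ^ K * 4 ^ K) := by ring
      have h6 : (s + 1) ^ 2 = (s + 1) * (s + 1) := by ring
      have : 0 < (s + 1) * (s + 1) := by positivity
      simp only [h6]
      omega
    · intro s hs r hr h
      simp only [Finset.coe_filter, Finset.mem_Ico, Set.mem_ofPred_eq] at hs hr
      have h1 : (s + 1) ^ 2 = s * s + 2 * s + 1 := by ring
      have h2 : (r + 1) ^ 2 = r * r + 2 * r + 1 := by ring
      simp only at h
      have h3 : (s + 1) ^ 2 = (r + 1) ^ 2 := by omega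
      have := Nat.pow_left_injective (n := 2) (by norm_num) h3
      omega
  have hsub : Finset.Ico (4 ^ K + i) (2 * 4 ^ K) ⊆
      (Finset.Ico (4 ^ K) (2 * 4 ^ K)).filter (fun s => i ≤ 2 * s) := by
    intro s hs
    simp only [Finset.mem_Ico, Finset.mem_filter] at hs ⊢
    omega
  have := (Finset.card_le_card hsub).trans hcard
  rw [Nat.card_Ico] at this
  omega

theorem infinite_row (i : ℕ) : {s | row s = i}.Infinite := by
  intro hfin
  have h1 := le_count_row (hfin.toFinset.card + i + 1) i
  have h2 : Nat.count (fun s => row s = i) (4 * 16 ^ (hfin.toFinset.card + i + 1)) ≤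
      hfin.toFinset.card := by
    rw [Nat.count_eq_card_filter_range]
    refine Finset.card_le_card fun s hs => ?_
    exact hfin.mem_toFinset.2 (Finset.mem_filter.1 hs).2
  have h3 : hfin.toFinset.card + i + 1 < 4 ^ (hfin.toFinset.card + i + 1) :=
    Nat.lt_pow_self (by norm_num)
  omega

/-- After window K the current row has been visited at least 4^K − row times, while until the end of
window K + 1 time stays below 4·16^(K+1) = 64·(4^K)². This is the polynomial growth needed for
continuity on s. -/
theorem le_mul_col_sq (t : ℕ) : t ≤ 64 * (row t + 1) ^ 2 * (col t + 1) ^ 2 := by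
  rcases lt_or_ge t 4 with h | h
  · have : 0 < (row t + 1) ^ 2 * (col t + 1) ^ 2 := by positivity
    rw [mul_assoc]; omega
  · obtain ⟨K, h1, h2⟩ : ∃ K, 4 * 16 ^ K ≤ t ∧ t < 4 * 16 ^ (K + 1) := by
      refine ⟨Nat.log 16 (t / 4), ?_, ?_⟩
      · have := Nat.pow_log_le_self 16 (x := t / 4) (by omega)
        omega
      · have := Nat.lt_pow_succ_log_self (b := 16) (by norm_num) (t / 4)
        simp only [Nat.succ_eq_add_one] at this
        omega
    have h3 : 4 ^ K ≤ col t + row t := (le_count_row K (row t)).trans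
      (Nat.add_le_add_right (Nat.count_monotone _ h1) _)
    have e16 : (16 : ℕ) ^ (K + 1) = 16 * (4 ^ K * 4 ^ K) := by rw [pow_succ, ← mul_pow]; norm_num [mul_comm]
    have h4 : 4 ^ K ≤ (row t + 1) * (col t + 1) := h3.trans (by nlinarith)
    have h5 := Nat.mul_le_mul h4 h4
    calc t ≤ 64 * (4 ^ K * 4 ^ K) := by omega
      _ ≤ 64 * (((row t + 1) * (col t + 1)) * ((row t + 1) * (col t + 1))) := by omega
      _ = _ := by ring

/-- The snake as a zero-based enumeration of all positions. -/
def enum : ℕ ≃ ℕ × ℕ where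
  toFun t := (row t, col t)
  invFun q := Nat.nth (fun s => row s = q.1) q.2
  left_inv t := Nat.nth_count (p := fun s => row s = row t) rfl
  right_inv q := by
    have h : row (Nat.nth (fun s => row s = q.1) q.2) = q.1 :=
      Nat.nth_mem_of_infinite (infinite_row q.1) q.2
    refine Prod.ext h ?_
    simp only [col, h]
    exact Nat.count_nth_of_infinite (infinite_row q.1) q.2

/-- The snake: the position reached at time `t`. -/
def pos : ℕ ≃ ℕ+ × ℕ+ :=
  enum.trans (Equiv.prodCongr Equiv.pnatEquivNat.symm Equiv.pnatEquivNat.symm)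

theorem pos_fst (t : ℕ) : (((pos t).1 : ℕ+) : ℕ) = row t + 1 := rfl

theorem pos_snd (t : ℕ) : (((pos t).2 : ℕ+) : ℕ) = col t + 1 := rfl

theorem pos_zero : pos 0 = (1, 1) := by
  refine Prod.ext (PNat.coe_injective ?_) (PNat.coe_injective ?_)
  · rw [pos_fst, row_zero]; rfl
  · rw [pos_snd, col, Nat.count_zero]; rfl

theorem pos_fst_le_succ (t : ℕ) : (pos t).1 ≤ (pos (t + 1)).1 + 1 := by
  rw [← PNat.coe_le_coe, PNat.add_coe, pos_fst, pos_fst]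
  simpa using row_le_succ t

theorem pos_snd_le (t : ℕ) : (((pos t).2 : ℕ+) : ℕ) ≤ t + 1 := by
  rw [pos_snd]
  exact Nat.succ_le_succ (Nat.count_le _)

theorem pos_snd_lt {s t : ℕ} (h : (pos s).1 = (pos t).1) (hst : s < t) :
    (pos s).2 < (pos t).2 := by
  rw [← PNat.coe_lt_coe, pos_snd, pos_snd]
  have h' : row s = row t := by
    have := congrArg (fun n : ℕ+ => (n : ℕ)) h
    simpa [pos_fst] using this
  refine Nat.succ_lt_succ ?_
  rw [col, col, h']
  exact Nat.count_strict_mono h' hst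

theorem pos_fst_eq_one {K t : ℕ} (h1 : 4 * 16 ^ K ≤ t) (h2 : t < 16 ^ (K + 1)) :
    (pos t).1 = 1 := PNat.coe_injective (by rw [pos_fst, row_eq_zero h1 h2]; rfl)

theorem le_mul_pos_snd_sq (t : ℕ) :
    t ≤ 64 * ((pos t).1 : ℕ) ^ 2 * ((pos t).2 : ℕ) ^ 2 := by
  rw [pos_fst, pos_snd]
  exact le_mul_col_sq t

/-- The snake map: one step back in time. -/
def back : {q : ℕ+ × ℕ+ // q ≠ (1, 1)} ≃ ℕ+ × ℕ+ where
  toFun q := pos (pos.symm q.1 - 1)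
  invFun q := ⟨pos (pos.symm q + 1), by
    rw [← pos_zero]
    exact fun h => Nat.succ_ne_zero _ (pos.injective h)⟩
  left_inv q := by
    have h : pos.symm q.1 ≠ 0 := fun h => q.2 ((Equiv.symm_apply_eq _).1 h |>.trans pos_zero)
    refine Subtype.ext ?_
    simp only [Equiv.symm_apply_apply]
    rw [Nat.sub_add_cancel (Nat.pos_of_ne_zero h), Equiv.apply_symm_apply]
  right_inv q := by simp

theorem back_symm_pos (t : ℕ) : (back.symm (pos t)).1 = pos (t + 1) := by
  simp [back]

/-! ### The times at which the blocks start -/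

/-- The time `l_k = 16 ^ k / 2`. -/
def time (k : ℕ) : ℕ := 16 ^ k / 2

theorem time_zero : time 0 = 0 := rfl

theorem time_succ (k : ℕ) : time (k + 1) = 8 * 16 ^ k := by
  rw [time, pow_succ]; omega

theorem two_mul_time_le (k : ℕ) : 2 * time k ≤ 16 ^ k := by
  rw [time]; omega

theorem time_strictMono : StrictMono time := by
  refine strictMono_nat_of_lt_succ fun k => ?_
  have := two_mul_time_le k
  have : 0 < 16 ^ k := by positivity
  rw [time_succ]; omega

theorem add_lt_time {i j k : ℕ} (hj : j < k) (hi : i ≤ k) : i + time j < time k := by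
  obtain ⟨k, rfl⟩ : ∃ r, k = r + 1 := ⟨k - 1, by omega⟩
  have h1 := two_mul_time_le j
  have h2 := Nat.pow_le_pow_right (n := 16) (by norm_num) (Nat.le_of_lt_succ hj)
  have h3 : k < 16 ^ k := Nat.lt_pow_self (by norm_num)
  rw [time_succ]; omega

theorem le_time_sub_time {i j k : ℕ} (hj : j < k) (hi : i ≤ k) :
    i ≤ time k - time j := by
  have := add_lt_time hj hi
  omega

/-- Since l_k = 8·16^(k−1) and l_j ≤ 16^(k−1)/2, the time l_k − l_j is inside the first-row window
from 4·16^(k−1) to 16^k, with room for k more steps. -/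
theorem pos_time_fst {i j k : ℕ} (hj : j < k) (hi : i ≤ k) :
    (pos (i + (time k - time j))).1 = 1 := by
  obtain ⟨k, rfl⟩ : ∃ r, k = r + 1 := ⟨k - 1, by omega⟩
  have h1 := two_mul_time_le j
  have h2 := Nat.pow_le_pow_right (n := 16) (by norm_num) (Nat.le_of_lt_succ hj)
  have h3 : k < 16 ^ k := Nat.lt_pow_self (by norm_num)
  have h4 := time_succ k
  exact pos_fst_eq_one (K := k) (by omega) (by rw [pow_succ]; omega)

/-- The index of the block that may contain the time `t`. -/
def block (t : ℕ) : ℕ := Nat.log 16 (2 * t)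

theorem block_add_time {k n : ℕ} (hn : n ≤ k) : block (n + time k) = k := by
  -- For k = 0 the time is 0, and the convention `Nat.log 16 0 = 0` gives the right block.
  rcases Nat.eq_zero_or_pos k with rfl | hk
  · obtain rfl : n = 0 := by omega
    rfl
  obtain ⟨k, rfl⟩ : ∃ r, k = r + 1 := ⟨k - 1, by omega⟩
  have h3 : k < 16 ^ k := Nat.lt_pow_self (by norm_num)
  rw [block, time_succ]
  refine (Nat.log_eq_iff (Or.inl (Nat.succ_ne_zero _))).2 ⟨?_, ?_⟩
  · rw [pow_succ]; omega
  · rw [pow_succ, pow_succ]; omega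

theorem time_block_le (t : ℕ) : time (block t) ≤ t := by
  rcases Nat.eq_zero_or_pos t with rfl | h
  · simp [block, time_zero]
  · have := Nat.pow_log_le_self 16 (x := 2 * t) (by omega)
    rw [time, block]; omega

end Snake

/-! ### Continuous linear maps on the locally convex direct sum -/

namespace LCDirectSum

variable {Y : Type} [AddCommGroup Y] [Module ℂ Y]

theorem linearMap_ext {E : Type*} [AddCommGroup E] [Module ℂ E] {L L' : LCDirectSum Y →ₗ[ℂ] E}
    (h : ∀ i, L ∘ₗ incl Y i = L' ∘ₗ incl Y i) : L = L' :=
  DirectSum.linearMap_ext ℂ h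

theorem induction_on {p : LCDirectSum Y → Prop} (z : LCDirectSum Y) (zero : p 0)
    (incl : ∀ i y, p (incl Y i y)) (add : ∀ z w, p z → p w → p (z + w)) : p z :=
  DirectSum.induction_on (β := fun _ : ℕ+ => Y) z zero incl add

variable [TopologicalSpace Y]

theorem firstSummandTopology_le :
    firstSummandTopology Y ≤ (instTopologicalSpaceSubtype : TopologicalSpace (firstSummand Y)) :=
  continuous_iff_coinduced_le.1 ((continuous_incl Y 1).subtype_mk _)

variable {E : Type*} [AddCommGroup E] [Module ℂ E] [TopologicalSpace E]
variable [IsTopologicalAddGroup E] [ContinuousSMul ℂ E] [LocallyConvexSpace ℝ E]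

/-- The topology induced by L is one of the locally convex topologies over which the infimum is
taken. -/
theorem continuous_of_comp_incl (L : LCDirectSum Y →ₗ[ℂ] E)
    (h : ∀ i, Continuous (L ∘ₗ incl Y i)) : Continuous L := by
  refine continuous_iff_le_induced.2 (sInf_le ⟨fun i => ?_, ?_, ?_, ?_⟩)
  · exact continuous_induced_rng.2 (h i)
  · exact topologicalAddGroup_induced L
  · exact continuousSMul_induced L
  · exact LocallyConvexSpace.induced (L.restrictScalars ℝ)

/-- The continuous linear map given by continuous linear maps on the summands. -/
def lift (φ : ℕ+ → Y →L[ℂ] E) : LCDirectSum Y →L[ℂ] E where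
  toLinearMap := DirectSum.toModule ℂ ℕ+ E fun i => (φ i).toLinearMap
  cont := continuous_of_comp_incl _ fun i => by
    have : (DirectSum.toModule ℂ ℕ+ E fun i => (φ i).toLinearMap) ∘ₗ incl Y i =
        (φ i).toLinearMap := LinearMap.ext fun y =>
        DirectSum.toModule_lof (M := fun _ => Y) (φ := fun i => (φ i).toLinearMap) ℂ i y
    exact this ▸ (φ i).continuous

@[simp] theorem lift_incl (φ : ℕ+ → Y →L[ℂ] E) (i : ℕ+) (y : Y) :
    lift φ (incl Y i y) = φ i y :=
  DirectSum.toModule_lof (M := fun _ => Y) (φ := fun i => (φ i).toLinearMap) ℂ i y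

variable (Y) in
/-- The inclusion of a summand as a continuous linear map. -/
def inclL (i : ℕ+) : Y →L[ℂ] LCDirectSum Y := ⟨incl Y i, continuous_incl Y i⟩

@[simp] theorem inclL_apply (i : ℕ+) (y : Y) : inclL Y i y = incl Y i y := rfl

variable [IsTopologicalAddGroup Y] [ContinuousSMul ℂ Y] [LocallyConvexSpace ℝ Y]

variable (Y) in
/-- The continuous projection onto a summand. -/
def proj (i : ℕ+) : LCDirectSum Y →L[ℂ] Y :=
  lift fun j => if j = i then ContinuousLinearMap.id ℂ Y else 0

theorem proj_incl (i j : ℕ+) (y : Y) : proj Y i (incl Y j y) = if j = i then y else 0 := by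
  rw [proj, lift_incl]; split_ifs <;> rfl

theorem eq_zero_of_proj (z : LCDirectSum Y) (h : ∀ i, proj Y i z = 0) : z = 0 := by
  refine DFinsupp.ext (β := fun _ : ℕ+ => Y) fun i => ?_
  have key : (proj Y i).toLinearMap = DirectSum.component ℂ ℕ+ (fun _ => Y) i := by
    refine linearMap_ext fun j => LinearMap.ext fun y => ?_
    refine (proj_incl i j y).trans ?_
    refine Eq.trans ?_ (DirectSum.component.of (R := ℂ) (M := fun _ : ℕ+ => Y) i j y).symm
    split_ifs with hij
    · subst hij; rfl
    · rfl
  exact (LinearMap.congr_fun key z).symm.trans (h i)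

instance [T2Space Y] : T2Space (LCDirectSum Y) := by
  refine T2Space.of_injective_continuous (f := fun z i => proj Y i z) (fun z w h => ?_)
    (continuous_pi fun i => (proj Y i).continuous)
  refine sub_eq_zero.1 (eq_zero_of_proj _ fun i => ?_)
  rw [map_sub, sub_eq_zero]
  exact congrFun h i

theorem incl_injective (i : ℕ+) : Function.Injective (incl Y i) := fun y z h => by
  have := congrArg (proj Y i) h
  simpa [proj_incl] using this

variable (Y) in
/-- The first summand is linearly isomorphic to `Y`. -/
def firstSummandEquiv : Y ≃ₗ[ℂ] firstSummand Y :=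
  LinearEquiv.ofInjective (incl Y 1) (incl_injective 1)

theorem coe_firstSummandEquiv (y : Y) :
    (firstSummandEquiv Y y : LCDirectSum Y) = incl Y 1 y := rfl

theorem tendsto_firstSummand {ι : Type*} {F : Filter ι} {v : ι → Y} (h : Tendsto v F (𝓝 0)) :
    Tendsto (fun k => firstSummandEquiv Y (v k)) F (@nhds _ (firstSummandTopology Y) 0) := by
  let := firstSummandTopology Y
  have hc : Continuous (firstSummandEquiv Y) := continuous_coinduced_rng
  have h0 := (hc.tendsto 0).comp h
  rwa [map_zero] at h0

end LCDirectSum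

theorem IsFSpace.coinduced {E F : Type*} [AddCommGroup E] [Module ℂ E] [TopologicalSpace E]
    [AddCommGroup F] [Module ℂ F] (h : IsFSpace E) (e : E ≃ₗ[ℂ] F) :
    @IsFSpace F _ _ (TopologicalSpace.coinduced e inferInstance) := by
  let τ : TopologicalSpace F := TopologicalSpace.coinduced e inferInstance
  have := h.isTopologicalAddGroup
  have := h.continuousSMul
  have := h.metrizable
  have he : Topology.IsInducing e.symm := ⟨by
    change TopologicalSpace.coinduced e.toEquiv _ = TopologicalSpace.induced e.toEquiv.symm _
    exact congrFun e.toEquiv.symm.coinduced_symm _⟩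
  have h1 : IsTopologicalAddGroup F := he.topologicalAddGroup e.symm
  have h2 : ContinuousSMul ℂ F := he.continuousSMul continuous_id (map_smul e.symm _ _)
  refine ⟨h1, h2, (Topology.IsEmbedding.mk he e.symm.injective).metrizableSpace, ?_⟩
  let := IsTopologicalAddGroup.rightUniformSpace E
  let := IsTopologicalAddGroup.rightUniformSpace F
  have := isUniformAddGroup_of_addCommGroup (G := E)
  have := isUniformAddGroup_of_addCommGroup (G := F)
  have : CompleteSpace E := h.complete
  have hc : Continuous e := continuous_coinduced_rng
  exact (UniformEquiv.completeSpace_iff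
    { e.toEquiv with
      uniformContinuous_toFun := uniformContinuous_addMonoidHom_of_continuous (f := e) hc
      uniformContinuous_invFun :=
        uniformContinuous_addMonoidHom_of_continuous (f := e.symm) he.continuous }).1 this

theorem IsFSpace.of_completeSpace (E : Type*) [AddCommGroup E] [Module ℂ E] [UniformSpace E]
    [IsUniformAddGroup E] [ContinuousSMul ℂ E] [TopologicalSpace.MetrizableSpace E]
    [CompleteSpace E] : IsFSpace E :=
  ⟨inferInstance, inferInstance, inferInstance, by
    rw [IsUniformAddGroup.rightUniformSpace_eq]; infer_instance⟩

/-! ### The space of rapidly decreasing sequences -/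

namespace RapidlyDecreasing

instance : IsTopologicalAddGroup RapidlyDecreasing := withSeminorms.topologicalAddGroup

instance : ContinuousSMul ℂ RapidlyDecreasing := withSeminorms.continuousSMul

instance : LocallyConvexSpace ℝ RapidlyDecreasing := withSeminorms.toLocallyConvexSpace

instance : FirstCountableTopology RapidlyDecreasing := withSeminorms.firstCountableTopology

@[ext] theorem ext {x y : RapidlyDecreasing} (h : ∀ n, x.1 n = y.1 n) : x = y :=
  Subtype.ext (funext h)

@[simp] theorem coe_sub (x y : RapidlyDecreasing) (n : ℕ+) : (x - y).1 n = x.1 n - y.1 n := rfl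

@[simp] theorem coe_add (x y : RapidlyDecreasing) (n : ℕ+) : (x + y).1 n = x.1 n + y.1 n := rfl

@[simp] theorem coe_smul (c : ℂ) (x : RapidlyDecreasing) (n : ℕ+) : (c • x).1 n = c * x.1 n := rfl

/-- The sequence of coordinates. -/
def coords : RapidlyDecreasing →ₗ[ℂ] (ℕ+ → ℂ) := rapidlyDecreasingSubmodule.subtype

theorem coords_apply (x : RapidlyDecreasing) (n : ℕ+) : coords x n = x.1 n := rfl

theorem seminorm_apply (k : ℕ) (x : RapidlyDecreasing) :
    seminorm k x = ∑' n : ℕ+, ‖x.1 n‖ * (n : ℝ) ^ k := rfl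

@[simp] theorem unit_coe (j n : ℕ+) : (unit j).1 n = (Pi.single j 1 : ℕ+ → ℂ) n := rfl

theorem coords_unit (j : ℕ+) : coords (unit j) = Pi.single j 1 := rfl

theorem norm_mul_pow_le (k : ℕ) (x : RapidlyDecreasing) (n : ℕ+) :
    ‖x.1 n‖ * (n : ℝ) ^ k ≤ seminorm k x :=
  (x.2 k).le_tsum n fun m _ => by positivity

theorem norm_le_seminorm (k : ℕ) (x : RapidlyDecreasing) (n : ℕ+) :
    ‖x.1 n‖ ≤ seminorm k x :=
  (le_mul_of_one_le_right (norm_nonneg _)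
    (one_le_pow₀ (by exact_mod_cast n.pos))).trans (norm_mul_pow_le k x n)

theorem seminorm_unit (k : ℕ) (j : ℕ+) : seminorm k (unit j) = (j : ℝ) ^ k := by
  rw [seminorm_apply, tsum_eq_single j fun n hn => ?_]
  · simp
  · simp [hn]

instance : T1Space RapidlyDecreasing :=
  withSeminorms.T1_of_separating fun x hx => by
    by_contra! h
    refine hx (ext fun n => ?_)
    have := norm_le_seminorm 0 x n
    rw [h 0] at this
    exact norm_le_zero_iff.1 this

instance : T2Space RapidlyDecreasing := inferInstance

/-- The element of `s` with given coordinates. -/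
def mk (x : ℕ+ → ℂ) (hx : ∀ k : ℕ, Summable fun n : ℕ+ => ‖x n‖ * (n : ℝ) ^ k) :
    RapidlyDecreasing := ⟨x, hx⟩

@[simp] theorem mk_coe (x : ℕ+ → ℂ) (hx) (n : ℕ+) : (mk x hx).1 n = x n := rfl

theorem coe_sum {ι : Type*} (F : Finset ι) (u : ι → RapidlyDecreasing) (n : ℕ+) :
    (∑ i ∈ F, u i).1 n = ∑ i ∈ F, (u i).1 n := by
  rw [← coords_apply, map_sum, Finset.sum_apply]; rfl

theorem hasSum_unit (x : RapidlyDecreasing) : HasSum (fun j => x.1 j • unit j) x := by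
  refine (withSeminorms.tendsto_nhds _ _).2 fun k ε hε => ?_
  have h := (x.2 k).hasSum
  have h1 := h.eventually (lt_mem_nhds (sub_lt_self _ hε))
  filter_upwards [h1] with F hF
  -- The error is supported off F, so its seminorm is the tail of the convergent series defining the
  -- seminorm of x.
  have h2 : seminorm k (∑ j ∈ F, x.1 j • unit j - x) + ∑ n ∈ F, ‖x.1 n‖ * (n : ℝ) ^ k ≤
      seminorm k x := by
    rw [seminorm_apply, seminorm_apply, ← (x.2 k).sum_add_tsum_compl (s := F), add_comm]
    refine add_le_add_right (le_of_eq ?_) _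
    rw [← tsum_subtype_eq_of_support_subset (s := (↑F : Set ℕ+)ᶜ)]
    · refine tsum_congr fun n => ?_
      have hn : (n : ℕ+) ∉ F := n.2
      rw [coe_sub, coe_sum, Finset.sum_eq_zero]
      · simp
      · intro j hj
        have : (n : ℕ+) ≠ j := fun h => hn (h ▸ hj)
        simp [this]
    · intro n hn
      by_contra h
      have hn' : n ∈ F := by simpa using h
      refine hn ?_
      simp only
      rw [coe_sub, coe_sum, Finset.sum_eq_single n]
      · simp
      · intro j _ hj
        simp [hj.symm]
      · exact fun h => absurd hn' h
  rw [seminorm_apply k x] at h2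
  linarith

theorem dense_span_unit : Dense (Submodule.span ℂ (Set.range unit) : Set RapidlyDecreasing) := by
  refine fun x => mem_closure_of_tendsto (hasSum_unit x) (Eventually.of_forall ?_)
  exact fun F => Submodule.sum_mem _ fun j _ =>
    Submodule.smul_mem _ _ (Submodule.subset_span ⟨j, rfl⟩)

/-- Reindexing of coordinates is continuous if indices grow polynomially. -/
theorem exists_reindex (A : Set ℕ+) (g : ℕ+ → ℕ+) (hg : Set.InjOn g A) (C : ℕ)
    (hC : ∀ m ∈ A, (m : ℕ) ≤ C * (g m : ℕ) ^ 2) :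
    ∃ R : RapidlyDecreasing →L[ℂ] RapidlyDecreasing,
      ∀ x, coords (R x) = A.indicator (fun m => coords x (g m)) := by
  -- The factor m^k is at most C^k·g(m)^(2k), and injectivity of g on A bounds the sum over g(A) by
  -- the full series; continuity thus costs a doubling of the seminorm index.
  have key : ∀ (x : RapidlyDecreasing) (k : ℕ) (F : Finset ℕ+),
      ∑ m ∈ F, ‖A.indicator (fun m => x.1 (g m)) m‖ * (m : ℝ) ^ k ≤
        (C : ℝ) ^ k * seminorm (2 * k) x := by
    intro x k F
    classical
    rw [← Finset.sum_filter_add_sum_filter_not F (· ∈ A), Finset.sum_eq_zero (s := F.filter (· ∉ A)),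
      add_zero]
    · calc _ ≤ ∑ m ∈ F.filter (· ∈ A), (C : ℝ) ^ k * (‖x.1 (g m)‖ * (g m : ℝ) ^ (2 * k)) := by
            refine Finset.sum_le_sum fun m hm => ?_
            have hm' := (Finset.mem_filter.1 hm).2
            rw [Set.indicator_of_mem hm']
            have h1 : ((m : ℕ) : ℝ) ≤ C * (g m : ℝ) ^ 2 := by exact_mod_cast hC m hm'
            calc ‖x.1 (g m)‖ * (m : ℝ) ^ k ≤ ‖x.1 (g m)‖ * (C * (g m : ℝ) ^ 2) ^ k := by gcongr
              _ = _ := by rw [mul_pow, ← pow_mul]; ring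
        _ = (C : ℝ) ^ k * ∑ j ∈ (F.filter (· ∈ A)).image g, ‖x.1 j‖ * (j : ℝ) ^ (2 * k) := by
            rw [← Finset.mul_sum, Finset.sum_image]
            intro a ha b hb h
            exact hg (Finset.mem_filter.1 ha).2 (Finset.mem_filter.1 hb).2 h
        _ ≤ _ := by
            gcongr
            exact (x.2 (2 * k)).sum_le_tsum _ fun j _ => by positivity
    · intro m hm
      rw [Set.indicator_of_notMem (Finset.mem_filter.1 hm).2]; simp
  have hs : ∀ (x : RapidlyDecreasing) (k : ℕ),
      Summable fun m : ℕ+ => ‖A.indicator (fun m => x.1 (g m)) m‖ * (m : ℝ) ^ k := fun x k =>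
    summable_of_sum_le (fun m => by positivity) (key x k)
  let R : RapidlyDecreasing →ₗ[ℂ] RapidlyDecreasing :=
    { toFun := fun x => mk (A.indicator fun m => x.1 (g m)) (hs x)
      map_add' := fun x y => ext fun n => by
        by_cases h : n ∈ A <;> simp [h]
      map_smul' := fun c x => ext fun n => by
        by_cases h : n ∈ A <;> simp [h] }
  refine ⟨⟨R, ?_⟩, fun x => rfl⟩
  refine withSeminorms.continuous_of_isBounded withSeminorms R fun k =>
    ⟨{2 * k}, (C : NNReal) ^ k, fun x => ?_⟩
  refine (Real.tsum_le_of_sum_le (fun m => by positivity) (key x k)).trans (le_of_eq ?_)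
  simp [NNReal.smul_def]

theorem isFSpace : IsFSpace RapidlyDecreasing := by
  let := IsTopologicalAddGroup.rightUniformSpace RapidlyDecreasing
  have := isUniformAddGroup_of_addCommGroup (G := RapidlyDecreasing)
  have hcg : (uniformity RapidlyDecreasing).IsCountablyGenerated :=
    IsUniformAddGroup.uniformity_countably_generated
  refine ⟨inferInstance, inferInstance, UniformSpace.metrizableSpace, ?_⟩
  refine UniformSpace.complete_of_cauchySeq_tendsto fun u hu => ?_
  have h0 : ∀ (k : ℕ) (ε : ℝ), 0 < ε → ∃ N, ∀ m ≥ N, ∀ n ≥ N, seminorm k (u m - u n) < ε := by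
    intro k ε hε
    have h1 : Tendsto (fun q : ℕ × ℕ => u q.1 - u q.2) (atTop ×ˢ atTop) (𝓝 0) := by
      have := hu.tendsto_uniformity
      rw [uniformity_eq_comap_nhds_zero_swapped] at this
      simpa [Function.comp_def, ← prod_atTop_atTop_eq] using tendsto_comap.comp this
    have h2 := (withSeminorms.tendsto_nhds _ _).1 h1 k ε hε
    rw [prod_atTop_atTop_eq, eventually_atTop] at h2
    obtain ⟨⟨a, b⟩, h⟩ := h2
    refine ⟨max a b, fun m hm n hn => ?_⟩
    simpa using h (m, n) ⟨(le_max_left _ _).trans hm, (le_max_right _ _).trans hn⟩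
  have hcoord : ∀ j : ℕ+, ∃ c : ℂ, Tendsto (fun n => (u n).1 j) atTop (𝓝 c) := fun j => by
    refine cauchySeq_tendsto_of_complete (Metric.cauchySeq_iff.2 fun ε hε => ?_)
    obtain ⟨N, hN⟩ := h0 0 ε hε
    refine ⟨N, fun m hm n hn => ?_⟩
    rw [dist_eq_norm]
    exact (norm_le_seminorm 0 (u m - u n) j).trans_lt (hN m hm n hn)
  choose c hc using hcoord
  -- The Cauchy estimate passes to the coordinatewise limit over finite sets F, with N independent
  -- of F.
  have h3 : ∀ (k : ℕ) (ε : ℝ), 0 < ε → ∃ N, ∀ m ≥ N, ∀ F : Finset ℕ+,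
      ∑ j ∈ F, ‖(u m).1 j - c j‖ * (j : ℝ) ^ k ≤ ε := by
    intro k ε hε
    obtain ⟨N, hN⟩ := h0 k ε hε
    refine ⟨N, fun m hm F => ?_⟩
    have hlim : Tendsto (fun n => ∑ j ∈ F, ‖(u m).1 j - (u n).1 j‖ * (j : ℝ) ^ k) atTop
        (𝓝 (∑ j ∈ F, ‖(u m).1 j - c j‖ * (j : ℝ) ^ k)) :=
      tendsto_finsetSum _ fun j _ => ((tendsto_const_nhds.sub (hc j)).norm.mul_const _)
    refine le_of_tendsto hlim (eventually_atTop.2 ⟨N, fun n hn => ?_⟩)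
    exact (((u m - u n).2 k).sum_le_tsum F fun j _ => by positivity).trans (hN m hm n hn).le
  have hcs : ∀ k : ℕ, Summable fun j : ℕ+ => ‖c j‖ * (j : ℝ) ^ k := fun k => by
    obtain ⟨N, hN⟩ := h3 k 1 one_pos
    have h4 : Summable fun j : ℕ+ => ‖(u N).1 j - c j‖ * (j : ℝ) ^ k :=
      summable_of_sum_le (fun j => by positivity) (hN N le_rfl)
    refine (((u N).2 k).add h4).of_nonneg_of_le (fun j => by positivity) fun j => ?_
    rw [← add_mul]
    refine mul_le_mul_of_nonneg_right ?_ (by positivity)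
    have := norm_sub_le ((u N).1 j) ((u N).1 j - c j)
    simpa using this
  refine ⟨mk c hcs, (withSeminorms.tendsto_nhds_atTop _ _).2 fun k ε hε => ?_⟩
  obtain ⟨N, hN⟩ := h3 k (ε / 2) (half_pos hε)
  refine ⟨N, fun m hm => ?_⟩
  exact (Real.tsum_le_of_sum_le (fun j => by positivity) (hN m hm)).trans_lt (half_lt_self hε)

end RapidlyDecreasing

/-! ### Vectors with rational coefficients -/

/-- The complex number with given rational real and imaginary parts. -/
def ratComplex : ℚ × ℚ →+ ℂ where
  toFun q := ⟨q.1, q.2⟩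
  map_zero' := by simp [Complex.ext_iff]
  map_add' p q := by simp [Complex.ext_iff]

theorem denseRange_ratComplex : DenseRange ratComplex := by
  have h := Rat.isDenseEmbedding_coe_real.dense.prodMap Rat.isDenseEmbedding_coe_real.dense
  exact Complex.equivRealProdCLM.symm.surjective.denseRange.comp h
    Complex.equivRealProdCLM.symm.continuous

section RatComb

variable {κ : Type*} {E : Type*} [AddCommGroup E] [Module ℂ E]

/-- The finite linear combinations of a family with rational complex coefficients. -/
def ratComb (e : κ → E) : (κ →₀ ℚ × ℚ) →+ E :=
  Finsupp.liftAddHom fun k => ((LinearMap.toSpanSingleton ℂ E (e k)).toAddMonoidHom).comp ratComplex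

theorem ratComb_single (e : κ → E) (k : κ) (q : ℚ × ℚ) :
    ratComb e (Finsupp.single k q) = ratComplex q • e k := by
  simp [ratComb]

theorem ratComb_eq_sum (e : κ → E) (d : κ →₀ ℚ × ℚ) {F : Finset κ} (hF : d.support ⊆ F) :
    ratComb e d = ∑ k ∈ F, ratComplex (d k) • e k := by
  rw [ratComb, Finsupp.liftAddHom_apply, Finsupp.sum_of_support_subset _ hF _ (by simp)]
  rfl

variable [TopologicalSpace E] [IsTopologicalAddGroup E] [ContinuousSMul ℂ E]

theorem denseRange_ratComb {e : κ → E}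
    (he : Dense (Submodule.span ℂ (Set.range e) : Set E)) : DenseRange (ratComb e) := by
  have h1 : ∀ (k : κ) (c : ℂ), c • e k ∈ (ratComb e).range.topologicalClosure := by
    intro k c
    have hc : Continuous fun c : ℂ => c • e k := continuous_id.smul continuous_const
    refine map_mem_closure (f := fun c : ℂ => c • e k) hc (denseRange_ratComplex c) ?_
    rintro _ ⟨q, rfl⟩
    exact ⟨Finsupp.single k q, ratComb_single e k q⟩
  have h2 : (Submodule.span ℂ (Set.range e) : Set E) ⊆ (ratComb e).range.topologicalClosure := by
    intro x hx
    obtain ⟨c, rfl⟩ := (Finsupp.mem_span_range_iff_exists_finsupp).1 hx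
    exact AddSubgroup.sum_mem _ fun k _ => h1 k _
  intro x
  exact closure_minimal h2 (AddSubgroup.isClosed_topologicalClosure _) (he x)

end RatComb

/-- Coding k as a pair (a, b) makes the a-th rational vector appear for infinitely many k. It is
replaced by 0 until k bounds both its support and its coefficients. -/
theorem exists_coeff_enumeration : ∃ c : ℕ → ℕ → ℂ, (∀ k n, k < n → c k n = 0) ∧
    (∀ k n, ‖c k n‖ ≤ k) ∧
    ∀ d : ℕ →₀ ℚ × ℚ, ∀ N, ∃ k ≥ N, ∀ n, c k n = ratComplex (d n) := by
  classical
  obtain ⟨φ, hφ⟩ := exists_surjective_nat (ℕ →₀ ℚ × ℚ)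
  let ok : (ℕ →₀ ℚ × ℚ) → ℕ → Prop := fun d k =>
    ∀ n, (k < n → ratComplex (d n) = 0) ∧ ‖ratComplex (d n)‖ ≤ k
  refine ⟨fun k n => if ok (φ k.unpair.1) k then ratComplex (φ k.unpair.1 n) else 0, ?_, ?_, ?_⟩
  · intro k n hkn
    dsimp only
    split_ifs with h
    · exact (h n).1 hkn
    · rfl
  · intro k n
    dsimp only
    split_ifs with h
    · exact (h n).2
    · simp
  · intro d N
    obtain ⟨a, rfl⟩ := hφ d
    obtain ⟨M, hM⟩ := exists_nat_ge (∑ n ∈ (φ a).support, ‖ratComplex (φ a n)‖)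
    have hk : ∀ k, M + (φ a).support.sup id ≤ k → ok (φ a) k := by
      intro k hk n
      by_cases hn : n ∈ (φ a).support
      · have h1 : n ≤ (φ a).support.sup id := Finset.le_sup (f := id) hn
        refine ⟨fun h => by omega, ?_⟩
        refine (Finset.single_le_sum (f := fun n => ‖ratComplex (φ a n)‖)
          (fun _ _ => norm_nonneg _) hn).trans (hM.trans ?_)
        exact_mod_cast (by omega : M ≤ k)
      · rw [Finsupp.notMem_support_iff.1 hn]
        simp
    have h3 := Nat.right_le_pair a (N + (M + (φ a).support.sup id))
    refine ⟨Nat.pair a (N + (M + (φ a).support.sup id)), by omega, fun n => ?_⟩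
    simp only [Nat.unpair_pair]
    rw [if_pos (hk _ (by omega))]

/-! ### Sequence spaces on which the snake shift is defined -/

/-- A locally convex F-space of complex sequences with unit vectors `δ` that contains the rapidly
decreasing sequences and on which polynomially bounded injective reindexing is continuous. -/
structure IsSnakeSpace (Y : Type) [AddCommGroup Y] [Module ℂ Y] [TopologicalSpace Y]
    (δ : ℕ+ → Y) : Prop where
  locallyConvex : LocallyConvexSpace ℝ Y
  isFSpace : IsFSpace Y
  exists_embed : ∃ ι : RapidlyDecreasing →L[ℂ] Y, ∀ j, ι (RapidlyDecreasing.unit j) = δ j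
  dense_span : Dense (Submodule.span ℂ (Set.range δ) : Set Y)
  exists_coords : ∃ κ : Y →ₗ[ℂ] (ℕ+ → ℂ), Function.Injective κ ∧
    (∀ j, κ (δ j) = Pi.single j 1) ∧
    ∀ (A : Set ℕ+) (g : ℕ+ → ℕ+) (C : ℕ), Set.InjOn g A →
      (∀ m ∈ A, (m : ℕ) ≤ C * (g m : ℕ) ^ 2) →
      ∃ R : Y →L[ℂ] Y, ∀ y, κ (R y) = A.indicator (fun m => κ y (g m))

/-! ### The operators T and S on the direct sum -/

namespace Snake

variable {Y : Type} [AddCommGroup Y] [Module ℂ Y] {δ : ℕ+ → Y}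

/-- The unit vector at the position of the snake at time `t`. -/
def vec (δ : ℕ+ → Y) (t : ℕ) : LCDirectSum Y := unitVec Y δ (pos t)

/-- The unit vector at the position of the snake at time `t`, as a vector of finite support. -/
def finVec (δ : ℕ+ → Y) (t : ℕ) : finSupp Y δ := finUnitVec Y δ (pos t)

theorem coe_finVec (t : ℕ) : (finVec δ t : LCDirectSum Y) = vec δ t := rfl

theorem vec_of_fst {t : ℕ} (h : (pos t).1 = 1) :
    vec δ t = LCDirectSum.incl Y 1 (δ (pos t).2) := by
  rw [vec, unitVec, h]

variable [TopologicalSpace Y]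

section Operators

/-- R is the component of the unweighted backward step from row i to row i'. Coordinate m of its
image is read off at the successor of (i', m), if that lies in row i. -/
theorem exists_coordinate_map (hY : IsSnakeSpace Y δ) (i i' : ℕ+) :
    ∃ R : Y →L[ℂ] Y, ∀ j, (pos 0 = (i, j) → R (δ j) = 0) ∧
      ∀ t, pos (t + 1) = (i, j) → R (δ j) = if i' = (pos t).1 then δ (pos t).2 else 0 := by
  classical
  obtain ⟨κ, hinj, hκ, hR⟩ := hY.exists_coords
  have hg : Set.InjOn (fun m => (back.symm (i', m)).1.2) {m | (back.symm (i', m)).1.1 = i} := by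
    intro m hm m' hm' h
    have h1 : (back.symm (i', m)).1 = (back.symm (i', m')).1 :=
      Prod.ext (Eq.trans hm (Eq.symm hm')) h
    exact congrArg Prod.snd (back.symm.injective (Subtype.ext h1))
  -- If (i', m) is reached at time t, then m ≤ t + 1, and t + 1 is at most 64·i² times the square of
  -- the column at time t + 1.
  obtain ⟨R, hR⟩ := hR _ _ (64 * (i : ℕ) ^ 2) hg fun m hm => by
    obtain ⟨t, ht⟩ := pos.surjective (i', m)
    rw [Set.mem_ofPred_eq] at hm
    rw [← ht, back_symm_pos] at hm ⊢
    have h1 := pos_snd_le t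
    have h2 := le_mul_pos_snd_sq (t + 1)
    rw [hm] at h2
    rw [ht] at h1
    exact h1.trans h2
  have key : ∀ j m, κ (R (δ j)) m = if (back.symm (i', m)).1 = (i, j) then 1 else 0 := by
    intro j m
    rw [hR, hκ, Set.indicator_apply, Pi.single_apply, ← ite_and]
    exact if_congr ⟨fun h => Prod.ext h.1 h.2,
      fun h => ⟨congrArg Prod.fst h, congrArg Prod.snd h⟩⟩ rfl rfl
  refine ⟨R, fun j => ⟨fun h0 => hinj ?_, fun t ht => hinj ?_⟩⟩
  · funext m
    rw [key, map_zero, if_neg]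
    · rfl
    · rw [← h0, pos_zero]
      exact (back.symm (i', m)).2
  · funext m
    have h1 : (back.symm (i', m)).1 = (i, j) ↔ (i', m) = pos t := by
      rw [← ht, ← back_symm_pos t, ← Subtype.ext_iff]
      exact back.symm.injective.eq_iff
    rw [key, if_congr h1 rfl rfl]
    by_cases h5 : i' = (pos t).1
    · rw [if_pos h5, hκ, Pi.single_apply]
      exact if_congr ⟨fun h => congrArg Prod.snd h, fun h => Prod.ext h5 h⟩ rfl rfl
    · rw [if_neg h5, map_zero, if_neg fun h => h5 (congrArg Prod.fst h)]
      rfl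

theorem exists_row_map (hY : IsSnakeSpace Y δ) (lam : ℂ) (i : ℕ+) :
    ∃ φ : Y →L[ℂ] LCDirectSum Y, ∀ j,
      (pos 0 = (i, j) → φ (δ j) = 0) ∧ ∀ t, pos (t + 1) = (i, j) → φ (δ j) = lam • vec δ t := by
  choose R hR using exists_coordinate_map hY i
  have hφ : ∀ y, (lam • ∑ i' ∈ Finset.Icc 1 (i + 1), (LCDirectSum.inclL Y i').comp (R i')) y =
      lam • ∑ i' ∈ Finset.Icc 1 (i + 1), LCDirectSum.incl Y i' (R i' y) := fun y => by
    simp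
  refine ⟨lam • ∑ i' ∈ Finset.Icc 1 (i + 1), (LCDirectSum.inclL Y i').comp (R i'), fun j =>
    ⟨fun h0 => ?_, fun t ht => ?_⟩⟩
  · rw [hφ, Finset.sum_eq_zero, smul_zero]
    intro i' _
    rw [(hR i' j).1 h0, map_zero]
  · rw [hφ, Finset.sum_eq_single (pos t).1]
    · rw [((hR _ j).2 t ht), if_pos rfl, vec, unitVec]
    · intro i' _ hi'
      rw [((hR _ j).2 t ht), if_neg hi', map_zero]
    · intro h
      refine absurd (Finset.mem_Icc.2 ⟨one_le, ?_⟩) h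
      have := pos_fst_le_succ t
      rwa [ht] at this

theorem exists_forward (hY : IsSnakeSpace Y δ) (lam : ℂ) :
    ∃ T : LCDirectSum Y →L[ℂ] LCDirectSum Y, T (vec δ 0) = 0 ∧
      ∀ t, T (vec δ (t + 1)) = lam • vec δ t := by
  choose φ hφ using exists_row_map hY lam
  refine ⟨LCDirectSum.lift φ, ?_, fun t => ?_⟩
  · exact (LCDirectSum.lift_incl _ _ _).trans ((hφ _ _).1 rfl)
  · exact (LCDirectSum.lift_incl _ _ _).trans ((hφ _ _).2 t rfl)

variable [IsTopologicalAddGroup Y] [ContinuousSMul ℂ Y] [LocallyConvexSpace ℝ Y]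

/-- This makes the unit vectors a basis of their span, so that S can be prescribed on them; S need
not be continuous. -/
theorem linearIndependent_unitVec (hY : IsSnakeSpace Y δ) :
    LinearIndependent ℂ (unitVec Y δ) := by
  obtain ⟨κ, -, hκ, -⟩ := hY.exists_coords
  have h : LinearIndependent ℂ fun q : ℕ+ × ℕ+ => (Pi.single q 1 : ℕ+ × ℕ+ → ℂ) :=
    Pi.linearIndependent_single_one _ ℂ
  let L : LCDirectSum Y →ₗ[ℂ] (ℕ+ × ℕ+ → ℂ) :=
    LinearMap.pi fun q => LinearMap.proj q.2 ∘ₗ κ ∘ₗ (LCDirectSum.proj Y q.1).toLinearMap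
  refine LinearIndependent.of_comp L ?_
  convert h using 1
  funext q
  funext r
  change κ (LCDirectSum.proj Y r.1 (LCDirectSum.incl Y q.1 (δ q.2))) r.2 = _
  rw [LCDirectSum.proj_incl]
  by_cases h1 : q.1 = r.1
  · rw [if_pos h1, hκ, Pi.single_apply, Pi.single_apply]
    by_cases h2 : r.2 = q.2
    · rw [if_pos h2, if_pos (Prod.ext h1.symm h2)]
    · rw [if_neg h2, if_neg fun h => h2 (congrArg Prod.snd h)]
  · rw [if_neg h1, map_zero, Pi.single_apply, if_neg fun h => h1 (congrArg Prod.fst h).symm]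
    rfl

theorem exists_backward (hY : IsSnakeSpace Y δ) (lam : ℂ) :
    ∃ S : finSupp Y δ →ₗ[ℂ] finSupp Y δ, ∀ q : ℕ+ × ℕ+,
      S (finUnitVec Y δ q) = lam⁻¹ • finUnitVec Y δ (back.symm q).1 := by
  let b := Module.Basis.span (linearIndependent_unitVec hY)
  have hb : ∀ q, b q = finUnitVec Y δ q := fun q =>
    Module.Basis.span_apply (linearIndependent_unitVec hY) q
  refine ⟨b.constr ℂ fun q => lam⁻¹ • finUnitVec Y δ (back.symm q).1, fun q => ?_⟩
  rw [← hb q]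
  exact b.constr_basis ℂ _ q

end Operators

end Snake

/-! ### Iterates along the snake, blocks and tails -/

namespace Snake

variable {Y : Type} [AddCommGroup Y] [Module ℂ Y] {δ : ℕ+ → Y}

theorem backward_pow {lam : ℂ} {S : finSupp Y δ →ₗ[ℂ] finSupp Y δ}
    (hS : ∀ t, S (finVec δ t) = lam⁻¹ • finVec δ (t + 1)) (m t : ℕ) :
    (S ^ m) (finVec δ t) = (lam ^ m)⁻¹ • finVec δ (t + m) := by
  induction m with
  | zero => simp
  | succ m ih =>
    rw [pow_succ', Module.End.mul_apply, ih, map_smul, hS, smul_smul, pow_succ, mul_inv, add_assoc]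

/-! ### The blocks -/

/-- The vector of finite support with coefficients `c 0, …, c k` along the snake. -/
def blockVec (δ : ℕ+ → Y) (c : ℕ → ℕ → ℂ) (k : ℕ) : finSupp Y δ :=
  ∑ n ∈ Finset.range (k + 1), c k n • finVec δ n

theorem coe_blockVec (c : ℕ → ℕ → ℂ) (k : ℕ) :
    (blockVec δ c k : LCDirectSum Y) = ∑ n ∈ Finset.range (k + 1), c k n • vec δ n := by
  simp [blockVec, coe_finVec]

variable [TopologicalSpace Y]

section Powers

variable {lam : ℂ} {T : LCDirectSum Y →L[ℂ] LCDirectSum Y}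

theorem forward_pow_add (hT : ∀ t, T (vec δ (t + 1)) = lam • vec δ t) (m t : ℕ) :
    (T ^ m) (vec δ (t + m)) = lam ^ m • vec δ t := by
  induction m with
  | zero => simp
  | succ m ih =>
    rw [pow_succ, mul_apply_eq_comp, ← add_assoc, hT, map_smul, ih, smul_smul,
      pow_succ']

theorem forward_pow_of_lt (hT0 : T (vec δ 0) = 0) (hT : ∀ t, T (vec δ (t + 1)) = lam • vec δ t)
    {m t : ℕ} (h : t < m) : (T ^ m) (vec δ t) = 0 := by
  obtain ⟨r, rfl⟩ : ∃ r, m = r + 1 + t := ⟨m - 1 - t, by omega⟩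
  rw [pow_add, mul_apply_eq_comp]
  have := forward_pow_add hT t 0
  rw [zero_add] at this
  rw [this, map_smul, pow_succ, mul_apply_eq_comp, hT0, map_zero, smul_zero]

end Powers

/-- The coefficient of the sequence of blocks at time `t`. -/
def coeff (c : ℕ → ℕ → ℂ) (t : ℕ) : ℂ := c (block t) (t - time (block t))

section Coeff

variable {c : ℕ → ℕ → ℂ}

theorem coeff_add_time (c : ℕ → ℕ → ℂ) {k n : ℕ} (h : n ≤ k) : coeff c (n + time k) = c k n := by
  rw [coeff, block_add_time h, Nat.add_sub_cancel]

theorem exists_of_coeff_ne_zero (hc0 : ∀ k n, k < n → c k n = 0) {t : ℕ} (h : coeff c t ≠ 0) :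
    ∃ k n, n ≤ k ∧ t = n + time k := by
  refine ⟨block t, t - time (block t), ?_, (Nat.sub_add_cancel (time_block_le t)).symm⟩
  by_contra! hlt
  exact h (hc0 _ _ hlt)

/-- The coefficients of the image of the hypercyclic vector at time `time k` outside of the
`k`-th block. -/
def tail (lam : ℝ) (c : ℕ → ℕ → ℂ) (k t : ℕ) : ℂ :=
  if k < t then (lam : ℂ) ^ time k *
    (((lam : ℂ) ^ time (block (t + time k)))⁻¹ * coeff c (t + time k)) else 0

/-- Entry n of a block i ≤ k cannot contribute, because n ≤ i ≤ k < t; only later blocks remain,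
moved back by l_k. -/
theorem tail_eq_zero_or (lam : ℝ) (hc0 : ∀ k n, k < n → c k n = 0) (k t : ℕ) :
    tail lam c k t = 0 ∨ ∃ i n, k < i ∧ n ≤ i ∧ t = n + (time i - time k) ∧
      tail lam c k t = (lam : ℂ) ^ time k * (((lam : ℂ) ^ time i)⁻¹ * c i n) := by
  by_cases hkt : k < t
  · by_cases h : coeff c (t + time k) = 0
    · left; simp [tail, h]
    · obtain ⟨i, n, hn, ht⟩ := exists_of_coeff_ne_zero hc0 h
      have hi : k < i := by
        by_contra! hle
        have := time_strictMono.monotone hle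
        omega
      have := time_strictMono hi
      refine Or.inr ⟨i, n, hi, hn, by omega, ?_⟩
      rw [tail, if_pos hkt, ht, block_add_time hn, coeff_add_time c hn]
  · left; exact if_neg hkt

theorem pos_fst_of_tail (lam : ℝ) (hc0 : ∀ k n, k < n → c k n = 0) {k t : ℕ}
    (h : tail lam c k t ≠ 0) : (pos t).1 = 1 := by
  obtain ⟨i, n, hi, hn, rfl, -⟩ := (tail_eq_zero_or lam hc0 k t).resolve_left h
  exact pos_time_fst hi hn

/-- A nonzero entry sits at t = n + (l_i − l_k) with n ≤ i ≤ l_i − l_k, so t ≤ 2(l_i − l_k) and the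
weight λ^(−(l_i − l_k)) is at most λ^(−t/2). The factor t + 1 absorbs the coefficient bound i.
Independence of k is what dominated convergence needs. -/
theorem norm_tail_le {lam : ℝ} (hlam : 1 < lam) (hc0 : ∀ k n, k < n → c k n = 0)
    (hc : ∀ k n, ‖c k n‖ ≤ k) (k t : ℕ) :
    ‖tail lam c k t‖ ≤ ((t : ℝ) + 1) * (√lam)⁻¹ ^ t := by
  have h0 : 0 ≤ ((t : ℝ) + 1) * (√lam)⁻¹ ^ t := by positivity
  obtain h | ⟨i, n, hi, hn, ht, h⟩ := tail_eq_zero_or lam hc0 k t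
  · rwa [h, norm_zero]
  · have hpos : 0 < lam := one_pos.trans hlam
    have hiu : i ≤ time i - time k := le_time_sub_time hi le_rfl
    have hti := time_strictMono hi
    have e1 : lam ^ time i = lam ^ time k * lam ^ (time i - time k) := by
      rw [← pow_add]; congr 1; omega
    have e2 : ‖tail lam c k t‖ = (lam ^ (time i - time k))⁻¹ * ‖c i n‖ := by
      rw [h, norm_mul, norm_mul, norm_inv, norm_pow, norm_pow, Complex.norm_real,
        Real.norm_of_nonneg hpos.le, e1]
      field_simp
    have e3 : (lam ^ (time i - time k))⁻¹ ≤ (√lam)⁻¹ ^ t := by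
      have hs : 1 ≤ √lam := Real.one_le_sqrt.2 hlam.le
      rw [inv_pow]
      refine inv_anti₀ (by positivity) ?_
      calc √lam ^ t ≤ √lam ^ (2 * (time i - time k)) := pow_le_pow_right₀ hs (by omega)
        _ = _ := by rw [pow_mul, Real.sq_sqrt hpos.le]
    rw [e2, mul_comm]
    refine mul_le_mul ((hc i n).trans ?_) e3 (by positivity) (by positivity)
    exact_mod_cast (by omega : i ≤ t + 1)

theorem summable_tail_bound {lam : ℝ} (hlam : 1 < lam) (d : ℕ) :
    Summable fun t : ℕ => ((t : ℝ) + 1) * (√lam)⁻¹ ^ t * ((t : ℝ) + 1) ^ d := by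
  have hs : 1 < √lam := Real.lt_sqrt_of_sq_lt (by simpa using hlam)
  have hs0 : 0 < √lam := one_pos.trans hs
  have h1 : ‖(√lam)⁻¹‖ < 1 := by
    rw [norm_inv, Real.norm_of_nonneg hs0.le]
    exact inv_lt_one_of_one_lt₀ hs
  have h2 : Summable fun t : ℕ => ((t + 1 : ℕ) : ℝ) ^ (d + 1) * (√lam)⁻¹ ^ (t + 1) :=
    (summable_nat_add_iff (f := fun t : ℕ => (t : ℝ) ^ (d + 1) * (√lam)⁻¹ ^ t) 1).2
      (summable_pow_mul_geometric_of_norm_lt_one (d + 1) h1)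
  refine (h2.mul_left √lam).congr fun t => ?_
  have h3 : √lam * (√lam)⁻¹ = 1 := mul_inv_cancel₀ hs0.ne'
  push_cast
  linear_combination (((t : ℝ) + 1) ^ (d + 1) * (√lam)⁻¹ ^ t) * h3

end Coeff

/-- The column at time t is at most t + 1, so decay in time gives decay in the column. The series is
summed in s and then carried to the first summand. -/
theorem exists_firstRow (ι : RapidlyDecreasing →L[ℂ] Y)
    (hι : ∀ j, ι (RapidlyDecreasing.unit j) = δ j) (γ : ℕ → ℂ)
    (h1 : ∀ t, γ t ≠ 0 → (pos t).1 = 1)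
    (hs : ∀ d : ℕ, Summable fun t => ‖γ t‖ * ((t : ℝ) + 1) ^ d) :
    ∃ v : RapidlyDecreasing, HasSum (fun t => γ t • vec δ t) (LCDirectSum.incl Y 1 (ι v)) ∧
      ∀ d, RapidlyDecreasing.seminorm d v ≤ ∑' t, ‖γ t‖ * ((t : ℝ) + 1) ^ d := by
  have hinj : Function.Injective fun j : ℕ+ => pos.symm (1, j) := fun j j' h =>
    congrArg Prod.snd (pos.symm.injective h)
  have hle : ∀ (d : ℕ) (j : ℕ+), ‖γ (pos.symm (1, j))‖ * (j : ℝ) ^ d ≤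
      ‖γ (pos.symm (1, j))‖ * ((pos.symm (1, j) : ℝ) + 1) ^ d := fun d j => by
    have h := pos_snd_le (pos.symm (1, j))
    rw [Equiv.apply_symm_apply] at h
    have h' : ((j : ℕ) : ℝ) ≤ (pos.symm (1, j) : ℝ) + 1 := by exact_mod_cast h
    gcongr
  have hs' : ∀ d : ℕ, Summable fun j : ℕ+ => ‖γ (pos.symm (1, j))‖ * (j : ℝ) ^ d := fun d =>
    ((hs d).comp_injective hinj).of_nonneg_of_le (fun j => by positivity) (hle d)
  refine ⟨RapidlyDecreasing.mk (fun j => γ (pos.symm (1, j))) hs', ?_, fun d => ?_⟩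
  · refine (hinj.hasSum_iff fun t ht => ?_).1 ?_
    · by_contra hne
      refine ht ⟨(pos t).2, ?_⟩
      have h2 : γ t ≠ 0 := fun h => hne (by rw [h, zero_smul])
      exact pos.symm_apply_eq.2 (Prod.ext (h1 t h2).symm rfl)
    · have h3 := (RapidlyDecreasing.hasSum_unit
        (RapidlyDecreasing.mk (fun j => γ (pos.symm (1, j))) hs')).mapL
        ((LCDirectSum.inclL Y 1).comp ι)
      convert h3 using 1
      · funext j
        simp [hι, vec, unitVec]
      · rfl
  · rw [RapidlyDecreasing.seminorm_apply]
    exact (hs' d).tsum_le_tsum_of_inj _ hinj (fun t _ => by positivity) (hle d) (hs d)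

end Snake

/-! ### The orbit of the hypercyclic vector and sequential density -/

namespace Snake

variable {Y : Type} [AddCommGroup Y] [Module ℂ Y] {δ : ℕ+ → Y} [TopologicalSpace Y]
variable {c : ℕ → ℕ → ℂ} {lam : ℝ}

theorem exists_tails (hlam : 1 < lam) (hc0 : ∀ k n, k < n → c k n = 0)
    (hc : ∀ k n, ‖c k n‖ ≤ k) (ι : RapidlyDecreasing →L[ℂ] Y)
    (hι : ∀ j, ι (RapidlyDecreasing.unit j) = δ j) :
    ∃ w : ℕ → RapidlyDecreasing, Tendsto w atTop (𝓝 0) ∧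
      ∀ k, HasSum (fun t => tail lam c k t • vec δ t) (LCDirectSum.incl Y 1 (ι (w k))) := by
  have hle : ∀ (d k t : ℕ), ‖tail lam c k t‖ * ((t : ℝ) + 1) ^ d ≤
      ((t : ℝ) + 1) * (√lam)⁻¹ ^ t * ((t : ℝ) + 1) ^ d := fun d k t =>
    mul_le_mul_of_nonneg_right (norm_tail_le hlam hc0 hc k t) (by positivity)
  choose w hw hwd using fun k => exists_firstRow ι hι (tail lam c k)
    (fun t ht => pos_fst_of_tail lam hc0 ht)
    (fun d => (summable_tail_bound hlam d).of_nonneg_of_le (fun t => by positivity) (hle d k))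
  refine ⟨w, (RapidlyDecreasing.withSeminorms.tendsto_nhds _ _).2 fun d ε hε => ?_, hw⟩
  have h1 : Tendsto (fun k => ∑' t, ‖tail lam c k t‖ * ((t : ℝ) + 1) ^ d) atTop
      (𝓝 (∑' _ : ℕ, (0 : ℝ))) := by
    refine tendsto_tsum_of_dominated_convergence (summable_tail_bound hlam d) (fun t => ?_)
      (Eventually.of_forall fun k t => ?_)
    · refine tendsto_nhds_of_eventually_eq ?_
      filter_upwards [eventually_ge_atTop t] with k hk
      rw [tail, if_neg (not_lt.2 hk), norm_zero, zero_mul]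
    · rw [Real.norm_of_nonneg (by positivity)]
      exact hle d k t
  rw [tsum_zero] at h1
  filter_upwards [h1.eventually (gt_mem_nhds hε)] with k hk
  rw [sub_zero]
  exact (hwd k d).trans_lt hk

/-- `tail lam c 0` is the coefficient sequence of the hypercyclic vector. After l_k steps back it
splits into block k, at times up to k, and the tail beyond. -/
theorem tail_zero_smul (hlam : 1 < lam)
    (hc : ∀ k n, ‖c k n‖ ≤ k) (k t : ℕ) :
    tail lam c 0 (t + time k) * (lam : ℂ) ^ time k =
      tail lam c k t + if t ∈ Finset.range (k + 1) then c k t else 0 := by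
  have hl : (lam : ℂ) ^ time k ≠ 0 := pow_ne_zero _ (by exact_mod_cast (one_pos.trans hlam).ne')
  -- `tail lam c 0` omits time 0, which loses nothing because block 0 is zero.
  have h00 : c 0 0 = 0 := norm_le_zero_iff.1 (by simpa using hc 0 0)
  rcases Nat.eq_zero_or_pos (t + time k) with h | h
  · have ht : t = 0 := by omega
    have hk : k = 0 := by
      by_contra hk
      have := time_strictMono (Nat.pos_of_ne_zero hk)
      omega
    subst ht hk
    simp [tail, h00, time_zero]
  · have e1 : tail lam c 0 (t + time k) =
        ((lam : ℂ) ^ time (block (t + time k)))⁻¹ * coeff c (t + time k) := by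
      rw [tail, if_pos h, time_zero, pow_zero, one_mul, add_zero]
    rw [e1]
    by_cases hk : k < t
    · rw [tail, if_pos hk, if_neg (by simpa using hk), add_zero, mul_comm]
    · have hk' : t ≤ k := not_lt.1 hk
      rw [tail, if_neg hk, if_pos (by simpa [Nat.lt_succ_iff] using hk'), zero_add,
        block_add_time hk', coeff_add_time c hk']
      field_simp

section Dynamics

variable [IsTopologicalAddGroup Y] [ContinuousSMul ℂ Y] [LocallyConvexSpace ℝ Y] [T2Space Y]
  {T : LCDirectSum Y →L[ℂ] LCDirectSum Y} {w : ℕ → Y}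

/-- T^(l_k) kills the terms before time l_k and shifts the others. Uniqueness of sums in the
Hausdorff direct sum identifies the result. -/
theorem forward_pow_tail (hT0 : T (vec δ 0) = 0)
    (hT : ∀ t, T (vec δ (t + 1)) = (lam : ℂ) • vec δ t)
    (hlam : 1 < lam) (hc : ∀ k n, ‖c k n‖ ≤ k)
    (hw : ∀ k, HasSum (fun t => tail lam c k t • vec δ t) (LCDirectSum.incl Y 1 (w k))) (k : ℕ) :
    (T ^ time k) (LCDirectSum.incl Y 1 (w 0)) =
      blockVec δ c k + LCDirectSum.incl Y 1 (w k) := by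
  have h1 := (hw 0).mapL (T ^ time k)
  have h2 : ∑ i ∈ Finset.range (time k), (T ^ time k) (tail lam c 0 i • vec δ i) = 0 :=
    Finset.sum_eq_zero fun i hi => by
      rw [map_smul, forward_pow_of_lt hT0 hT (Finset.mem_range.1 hi), smul_zero]
  have h3 : HasSum (fun t => (T ^ time k) (tail lam c 0 (t + time k) • vec δ (t + time k)))
      ((T ^ time k) (LCDirectSum.incl Y 1 (w 0))) :=
    (hasSum_nat_add_iff (f := fun t => (T ^ time k) (tail lam c 0 t • vec δ t)) (time k)).2
      (by rw [h2, add_zero]; exact h1)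
  have h4 : HasSum (fun t => if t ∈ Finset.range (k + 1) then c k t • vec δ t else 0)
      (blockVec δ c k : LCDirectSum Y) := by
    rw [coe_blockVec, ← Finset.sum_congr rfl fun t ht => if_pos ht]
    exact hasSum_sum_of_ne_finset_zero fun t ht => if_neg ht
  refine h3.unique ?_
  rw [add_comm]
  convert (hw k).add h4 using 1
  funext t
  rw [map_smul, forward_pow_add hT, smul_smul, tail_zero_smul hlam hc, add_smul]
  congr 1
  split_ifs <;> simp

end Dynamics

/-- Sequences suffice because every element is a finite sum of elements of summands, and each
summand is first countable. -/
theorem exists_ratComb_tendsto [IsTopologicalAddGroup Y] [ContinuousSMul ℂ Y]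
    [FirstCountableTopology Y] (hδ : Dense (Submodule.span ℂ (Set.range δ) : Set Y))
    (z : LCDirectSum Y) :
    ∃ d : ℕ → ℕ →₀ ℚ × ℚ, Tendsto (fun m => ratComb (vec δ) (d m)) atTop (𝓝 z) := by
  induction z using LCDirectSum.induction_on with
  | zero => exact ⟨0, by simpa using tendsto_const_nhds⟩
  | add z w hz hw =>
    obtain ⟨d, hd⟩ := hz
    obtain ⟨d', hd'⟩ := hw
    exact ⟨d + d', by simpa using hd.add hd'⟩
  | incl i y =>
    obtain ⟨u, hu, hlim⟩ := mem_closure_iff_seq_limit.1 (denseRange_ratComb hδ y)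
    choose d hd using hu
    have key : ∀ d : ℕ+ →₀ ℚ × ℚ, ∃ d' : ℕ →₀ ℚ × ℚ,
        ratComb (vec δ) d' = LCDirectSum.incl Y i (ratComb δ d) := by
      intro d
      induction d using Finsupp.induction_linear with
      | zero => exact ⟨0, by simp⟩
      | add d e hd he =>
        obtain ⟨d', hd⟩ := hd
        obtain ⟨e', he⟩ := he
        exact ⟨d' + e', by rw [map_add, map_add, map_add, hd, he]⟩
      | single j q =>
        refine ⟨Finsupp.single (pos.symm (i, j)) q, ?_⟩
        rw [ratComb_single, ratComb_single, map_smul, vec, Equiv.apply_symm_apply, unitVec]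
    choose d' hd' using fun m => key (d m)
    refine ⟨d', ?_⟩
    simp only [hd', hd]
    exact ((LCDirectSum.continuous_incl Y i).tendsto y).comp hlim

theorem exists_blockVec_tendsto [IsTopologicalAddGroup Y] [ContinuousSMul ℂ Y]
    [FirstCountableTopology Y] (hδ : Dense (Submodule.span ℂ (Set.range δ) : Set Y))
    (hc0 : ∀ k n, k < n → c k n = 0)
    (hcd : ∀ d : ℕ →₀ ℚ × ℚ, ∀ N, ∃ k ≥ N, ∀ n, c k n = ratComplex (d n)) (z : LCDirectSum Y) :
    ∃ κ : ℕ → ℕ, StrictMono κ ∧ (∀ m, 0 < κ m) ∧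
      Tendsto (fun m => (blockVec δ c (κ m) : LCDirectSum Y)) atTop (𝓝 z) := by
  obtain ⟨d, hd⟩ := exists_ratComb_tendsto hδ z
  -- Each rational vector recurs for arbitrarily large k, so the indices can be chosen strictly
  -- increasing.
  obtain ⟨κ, hκ, h⟩ := extraction_forall_of_frequently
    (P := fun m k => 0 < k ∧ ∀ n, c k n = ratComplex (d m n)) fun m => by
      refine frequently_atTop.2 fun N => ?_
      obtain ⟨k, hk, h⟩ := hcd (d m) (N + 1)
      exact ⟨k, by omega, by omega, h⟩
  refine ⟨κ, hκ, fun m => (h m).1, hd.congr fun m => ?_⟩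
  have hF : (d m).support ∪ Finset.range (κ m + 1) ⊇ Finset.range (κ m + 1) :=
    Finset.subset_union_right
  rw [ratComb_eq_sum _ _ (Finset.subset_union_left (s₂ := Finset.range (κ m + 1))), coe_blockVec,
    ← Finset.sum_subset hF]
  · exact Finset.sum_congr rfl fun n _ => by rw [(h m).2 n]
  · intro n _ hn
    rw [← (h m).2 n, hc0 _ _ (by simpa using hn), zero_smul]

end Snake

/-! ### Blocks as intervals of columns, and the limits in the criterion -/

namespace Snake

theorem pos_add_time_fst {k n : ℕ} (hk : 1 ≤ k) (hn : n ≤ k) : (pos (n + time k)).1 = 1 :=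
  pos_time_fst (j := 0) hk hn

theorem firstRow_strictMono : StrictMono fun j : ℕ+ => pos.symm (1, j) := by
  intro j j' h
  by_contra! hle
  rcases hle.eq_or_lt with h1 | h1
  · exact h.ne' (congrArg Prod.snd (pos.symm.injective h1))
  · have := pos_snd_lt (s := pos.symm (1, j')) (t := pos.symm (1, j)) (by simp) h1
    simp only [Equiv.apply_symm_apply] at this
    exact lt_asymm h this

theorem symm_one_snd {t : ℕ} (h : (pos t).1 = 1) : pos.symm (1, (pos t).2) = t := by
  rw [pos.symm_apply_eq, ← h]

/-- First-row columns are numbered in order of time, and the block is a time interval spent in the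
first row, so it is an interval of columns. -/
theorem mem_Icc_block {k : ℕ} (hk : 1 ≤ k) (j : ℕ+) :
    j ∈ Finset.Icc (pos (time k)).2 (pos (k + time k)).2 ↔
      time k ≤ pos.symm (1, j) ∧ pos.symm (1, j) ≤ k + time k := by
  have h0 := symm_one_snd (pos_add_time_fst hk (Nat.zero_le k))
  have h1 := symm_one_snd (pos_add_time_fst hk le_rfl)
  rw [zero_add] at h0
  rw [Finset.mem_Icc, ← firstRow_strictMono.le_iff_le, ← firstRow_strictMono.le_iff_le (b := _)]
  simp only [h0, h1]

theorem sum_Icc_block {M : Type*} [AddCommMonoid M] {k : ℕ} (hk : 1 ≤ k) (G : ℕ → M) :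
    ∑ j ∈ Finset.Icc (pos (time k)).2 (pos (k + time k)).2, G (pos.symm (1, j)) =
      ∑ n ∈ Finset.range (k + 1), G (n + time k) := by
  refine Finset.sum_nbij' (fun j => pos.symm (1, j) - time k) (fun n => (pos (n + time k)).2)
    (fun j hj => ?_) (fun n hn => ?_) (fun j hj => ?_) (fun n hn => ?_) (fun j hj => ?_)
  · have := (mem_Icc_block hk j).1 hj
    rw [Finset.mem_range]; omega
  · have hn' := Nat.le_of_lt_succ (Finset.mem_range.1 hn)
    rw [mem_Icc_block hk, symm_one_snd (pos_add_time_fst hk hn')]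
    omega
  · have := (mem_Icc_block hk j).1 hj
    rw [Nat.sub_add_cancel this.1, Equiv.apply_symm_apply]
  · have hn' := Nat.le_of_lt_succ (Finset.mem_range.1 hn)
    rw [symm_one_snd (pos_add_time_fst hk hn')]
    omega
  · have := (mem_Icc_block hk j).1 hj
    rw [Nat.sub_add_cancel this.1]

theorem tendsto_inv_pow_smul_unit {lam : ℝ} (hlam : 1 < lam) (n a : ℕ) :
    Tendsto (fun k => ((lam : ℂ) ^ time k)⁻¹ •
      RapidlyDecreasing.unit (pos (n + (time k - a))).2) atTop (𝓝 0) := by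
  refine (RapidlyDecreasing.withSeminorms.tendsto_nhds _ _).2 fun d ε hε => ?_
  have h1 : Tendsto (fun k => ((n : ℝ) + 2) ^ d * ((time k : ℝ) ^ d / lam ^ time k)) atTop
      (𝓝 0) := by
    have := ((tendsto_pow_const_div_const_pow_of_one_lt d hlam).comp
      time_strictMono.tendsto_atTop).const_mul (((n : ℝ) + 2) ^ d)
    simpa [Function.comp_def] using this
  filter_upwards [h1.eventually (gt_mem_nhds hε), eventually_ge_atTop 1] with k hk hk1
  rw [sub_zero, map_smul_eq_mul, RapidlyDecreasing.seminorm_unit, norm_inv, norm_pow,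
    Complex.norm_real, Real.norm_of_nonneg (one_pos.trans hlam).le]
  refine lt_of_le_of_lt ?_ hk
  have h2 : 1 ≤ time k := Nat.succ_le_of_lt (time_strictMono hk1)
  have h3 := pos_snd_le (n + (time k - a))
  -- The column is at most n + l_k + 1, and l_k ≥ 1. A power of l_k then loses against λ^(l_k).
  have h4 : ((pos (n + (time k - a))).2 : ℕ) ≤ (n + 2) * time k := by nlinarith [Nat.sub_le (time k) a]
  have h5 : (((pos (n + (time k - a))).2 : ℕ) : ℝ) ≤ ((n : ℝ) + 2) * time k := by exact_mod_cast h4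
  calc (lam ^ time k)⁻¹ * (((pos (n + (time k - a))).2 : ℕ) : ℝ) ^ d
      ≤ (lam ^ time k)⁻¹ * (((n : ℝ) + 2) * time k) ^ d := by
        have : 0 < lam := one_pos.trans hlam
        gcongr
    _ = _ := by rw [mul_pow]; ring

variable {Y : Type} [AddCommGroup Y] [Module ℂ Y] {δ : ℕ+ → Y}
variable {c : ℕ → ℕ → ℂ} {lam : ℂ} {S : finSupp Y δ →ₗ[ℂ] finSupp Y δ}

theorem coe_backward_pow_blockVec (hS : ∀ t, S (finVec δ t) = lam⁻¹ • finVec δ (t + 1))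
    (r i : ℕ) : ((S ^ r) (blockVec δ c i) : LCDirectSum Y) =
      ∑ n ∈ Finset.range (i + 1), (lam ^ r)⁻¹ • c i n • vec δ (n + r) := by
  simp only [blockVec, map_sum, map_smul, backward_pow hS, Submodule.coe_sum, Submodule.coe_smul,
    coe_finVec]
  exact Finset.sum_congr rfl fun n _ => smul_comm _ _ _

theorem backward_pow_blockVec_eq_sum_Icc
    (hS : ∀ t, S (finVec δ t) = lam⁻¹ • finVec δ (t + 1)) {k : ℕ} (hk : 1 ≤ k) :
    ((S ^ time k) (blockVec δ c k) : LCDirectSum Y) =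
      ∑ j ∈ Finset.Icc (pos (time k)).2 (pos (k + time k)).2,
        (lam ^ time k)⁻¹ • coeff c (pos.symm (1, j)) • unitVec Y δ (1, j) := by
  have h := sum_Icc_block hk fun t => (lam ^ time k)⁻¹ • coeff c t • vec δ t
  simp only [vec, Equiv.apply_symm_apply] at h
  rw [h, coe_backward_pow_blockVec hS]
  refine Finset.sum_congr rfl fun n hn => ?_
  rw [coeff_add_time c (Nat.le_of_lt_succ (Finset.mem_range.1 hn)), vec]

variable [TopologicalSpace Y] {T : LCDirectSum Y →L[ℂ] LCDirectSum Y}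

theorem forward_pow_backward_pow_blockVec (hlam : lam ≠ 0)
    (hT : ∀ t, T (vec δ (t + 1)) = lam • vec δ t)
    (hS : ∀ t, S (finVec δ t) = lam⁻¹ • finVec δ (t + 1)) (r i : ℕ) :
    (T ^ r) ((S ^ r) (blockVec δ c i) : LCDirectSum Y) = blockVec δ c i := by
  rw [coe_backward_pow_blockVec hS, coe_blockVec, map_sum]
  refine Finset.sum_congr rfl fun n _ => ?_
  rw [map_smul, map_smul, forward_pow_add hT, smul_comm (c i n), smul_smul,
    inv_mul_cancel₀ (pow_ne_zero _ hlam), one_smul]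

theorem forward_pow_time_eq_zero (hT0 : T (vec δ 0) = 0)
    (hT : ∀ t, T (vec δ (t + 1)) = lam • vec δ t)
    (hS : ∀ t, S (finVec δ t) = lam⁻¹ • finVec δ (t + 1)) {i j k : ℕ} (h : j + i < k) :
    (T ^ time k) ((S ^ time j) (blockVec δ c i) : LCDirectSum Y) = 0 := by
  rw [coe_backward_pow_blockVec hS, map_sum]
  refine Finset.sum_eq_zero fun n hn => ?_
  have hn' := Finset.mem_range.1 hn
  rw [map_smul, map_smul,
    forward_pow_of_lt hT0 hT (add_lt_time (i := n) (j := j) (k := k) (by omega) (by omega)),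
    smul_zero, smul_zero]

theorem forward_pow_time_eq_incl (hT : ∀ t, T (vec δ (t + 1)) = lam • vec δ t)
    (hS : ∀ t, S (finVec δ t) = lam⁻¹ • finVec δ (t + 1)) {i j k : ℕ} (h : j + i < k) :
    (T ^ time j) ((S ^ time k) (blockVec δ c i) : LCDirectSum Y) =
      LCDirectSum.incl Y 1 (∑ n ∈ Finset.range (i + 1), (c i n * lam ^ time j) •
        (lam ^ time k)⁻¹ • δ (pos (n + (time k - time j))).2) := by
  rw [coe_backward_pow_blockVec hS, map_sum, map_sum]
  refine Finset.sum_congr rfl fun n hn => ?_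
  have hn' := Finset.mem_range.1 hn
  have hjk := time_strictMono (show j < k by omega)
  have e : n + time k = n + (time k - time j) + time j := by omega
  rw [map_smul, map_smul, e, forward_pow_add hT,
    vec_of_fst (pos_time_fst (i := n) (j := j) (k := k) (by omega) (by omega)), map_smul, map_smul,
    smul_smul (c i n), smul_comm]

end Snake

/-! ### Assembly for a general sequence space -/

open Snake in
theorem IsSnakeSpace.snakeShiftProperty {Y : Type} [AddCommGroup Y] [Module ℂ Y]
    [TopologicalSpace Y] {δ : ℕ+ → Y} (hY : IsSnakeSpace Y δ) {lam : ℝ} (hlam : 1 < lam) :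
    SnakeShiftProperty Y δ back lam := by
  have := hY.locallyConvex
  have := hY.isFSpace.isTopologicalAddGroup
  have := hY.isFSpace.continuousSMul
  have := hY.isFSpace.metrizable
  have hlam0 : (lam : ℂ) ≠ 0 := by exact_mod_cast (one_pos.trans hlam).ne'
  obtain ⟨c, hc0, hc, hcd⟩ := exists_coeff_enumeration
  obtain ⟨T, hT0, hT⟩ := exists_forward hY lam
  obtain ⟨S, hSq⟩ := exists_backward hY lam
  have hS : ∀ t, S (finVec δ t) = (lam : ℂ)⁻¹ • finVec δ (t + 1) := fun t => by
    rw [finVec, hSq, back_symm_pos]; rfl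
  obtain ⟨ι, hι⟩ := hY.exists_embed
  refine ⟨T, S, ?_, fun q => ?_, hSq, ?_, ?_⟩
  · rw [← pos_zero]; exact hT0
  · obtain ⟨r, rfl⟩ := back.symm.surjective q
    obtain ⟨t, rfl⟩ := pos.surjective r
    rw [back_symm_pos, Equiv.apply_symm_apply]
    exact hT t
  · refine ⟨fun k => blockVec δ c k, time, fun k => (pos (time k)).2,
      fun k => (pos (k + time k)).2, fun j => coeff c (pos.symm (1, j)), fun j k h => ?_,
      fun j k h => ?_, fun k => ?_, fun k j hj => ?_, fun k => ?_, fun k => ?_,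
      fun i j k h => ?_, fun i j k h => ?_, ?_, ?_⟩
    · have h1 := pos_add_time_fst j.pos (Nat.zero_le j)
      have h2 := pos_add_time_fst k.pos (Nat.zero_le k)
      rw [zero_add] at h1 h2
      exact pos_snd_lt (h1.trans h2.symm) (time_strictMono h)
    · have h1 := pos_add_time_fst j.pos le_rfl
      have h2 := pos_add_time_fst k.pos le_rfl
      have h3 : (j : ℕ) < k := h
      have h4 := time_strictMono h3
      exact pos_snd_lt (h1.trans h2.symm) (by omega)
    · have h1 := (mem_Icc_block k.pos (pos (time k)).2).2 (by
        have h1 := pos_add_time_fst k.pos (Nat.zero_le k)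
        rw [zero_add] at h1
        rw [symm_one_snd h1]; omega)
      exact (Finset.mem_Icc.1 h1).2
    · obtain ⟨h1, h2⟩ := (mem_Icc_block k.pos j).1 hj
      obtain ⟨n, hn⟩ : ∃ n, pos.symm (1, j) = n + time k := ⟨_, (Nat.sub_add_cancel h1).symm⟩
      have h3 := hc k n
      rwa [← coeff_add_time c (show n ≤ k by omega), ← hn] at h3
    · rw [← backward_pow_blockVec_eq_sum_Icc hS k.pos]
      exact forward_pow_backward_pow_blockVec hlam0 hT hS _ _
    · exact backward_pow_blockVec_eq_sum_Icc hS k.pos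
    · exact forward_pow_time_eq_zero hT0 hT hS h
    · rw [forward_pow_time_eq_incl hT hS (show (j : ℕ) + i < k from h)]
      exact ⟨_, rfl⟩
    · rintro _ ⟨k, rfl⟩
      exact (blockVec δ c k).2
    · refine ⟨Set.countable_range _, fun z => ?_, LCDirectSum.firstSummandTopology_le,
        hY.isFSpace.coinduced (LCDirectSum.firstSummandEquiv Y), time_zero, time_strictMono,
        ?_, ?_, ?_⟩
      · obtain ⟨κ, -, hκ, h⟩ := exists_blockVec_tendsto hY.dense_span hc0 hcd z
        exact ⟨_, fun m => ⟨⟨κ m, hκ m⟩, rfl⟩, h⟩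
      · rintro ⟨_, i, rfl⟩ j -
        refine ⟨fun _ => LCDirectSum.firstSummandEquiv Y 0, ?_,
          LCDirectSum.tendsto_firstSummand tendsto_const_nhds⟩
        filter_upwards [eventually_gt_atTop (j + i)] with k hk
        rw [map_zero]
        exact (forward_pow_time_eq_zero hT0 hT hS hk).symm
      · rintro ⟨_, i, rfl⟩ j
        -- The convergence is obtained in s and transported by ι, which treats all spaces Y at once.
        refine ⟨_, ?_, LCDirectSum.tendsto_firstSummand (v := fun k => ι
          (∑ n ∈ Finset.range (i + 1), (c i n * (lam : ℂ) ^ time j) • ((lam : ℂ) ^ time k)⁻¹ •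
            RapidlyDecreasing.unit (pos (n + (time k - time j))).2)) ?_⟩
        · filter_upwards [eventually_gt_atTop (j + i)] with k hk
          refine Eq.trans ?_ (forward_pow_time_eq_incl hT hS hk).symm
          rw [LCDirectSum.coe_firstSummandEquiv]
          simp only [map_sum, map_smul, hι]
        · have h := tendsto_finsetSum (Finset.range ((i : ℕ) + 1)) fun n _ =>
            (tendsto_inv_pow_smul_unit hlam n (time j)).const_smul (c i n * (lam : ℂ) ^ time j)
          have h' := (ι.continuous.tendsto _).comp h
          simpa [Function.comp_def] using h'
      · rintro ⟨_, i, rfl⟩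
        refine ⟨fun _ => LCDirectSum.firstSummandEquiv Y 0, Eventually.of_forall fun k => ?_,
          LCDirectSum.tendsto_firstSummand tendsto_const_nhds⟩
        rw [map_zero]
        have := forward_pow_backward_pow_blockVec (c := c) hlam0 hT hS (time k) i
        exact (sub_eq_zero.2 this.symm).symm
  · obtain ⟨w, hw0, hw⟩ := exists_tails hlam hc0 hc ι hι
    -- This is ∑ S_(l_k) x_k. Along times l_κ(m) its image is x_κ(m) plus a tail tending to 0.
    refine ⟨LCDirectSum.incl Y 1 (ι (w 0)), fun y => ?_⟩
    obtain ⟨κ, hκ, -, h⟩ := exists_blockVec_tendsto hY.dense_span hc0 hcd y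
    refine ⟨fun m => time (κ m), time_strictMono.comp hκ, ?_⟩
    have h1 : Tendsto (fun m => LCDirectSum.incl Y 1 (ι (w (κ m)))) atTop (𝓝 0) := by
      have := (((LCDirectSum.inclL Y 1).comp ι).continuous.tendsto 0).comp
        (hw0.comp hκ.tendsto_atTop)
      rwa [map_zero] at this
    have h2 := h.add h1
    rw [add_zero] at h2
    refine h2.congr fun m => ?_
    exact (forward_pow_tail (w := fun k => ι (w k)) hT0 hT hlam hc hw (κ m)).symm

/-! ### The sequence spaces `s`, `ℓ^p` and `c₀` -/

theorem RapidlyDecreasing.isSnakeSpace :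
    IsSnakeSpace RapidlyDecreasing RapidlyDecreasing.unit where
  locallyConvex := inferInstance
  isFSpace := RapidlyDecreasing.isFSpace
  exists_embed := ⟨ContinuousLinearMap.id ℂ _, fun _ => rfl⟩
  dense_span := RapidlyDecreasing.dense_span_unit
  exists_coords := ⟨RapidlyDecreasing.coords, Subtype.coe_injective,
    RapidlyDecreasing.coords_unit, fun A g C hg hC =>
      RapidlyDecreasing.exists_reindex A g hg C hC⟩

/-- A Banach space of sequences whose unit vectors have norm at most one and dense span, and on
which injective reindexing does not increase the norm. -/
theorem IsSnakeSpace.of_banach {Y : Type} [NormedAddCommGroup Y] [NormedSpace ℂ Y]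
    [CompleteSpace Y] {δ : ℕ+ → Y} (hδ : ∀ j, ‖δ j‖ ≤ 1)
    (hdense : Dense (Submodule.span ℂ (Set.range δ) : Set Y))
    (κ : Y →ₗ[ℂ] (ℕ+ → ℂ)) (hinj : Function.Injective κ) (hκ : ∀ j, κ (δ j) = Pi.single j 1)
    (hR : ∀ (A : Set ℕ+) (g : ℕ+ → ℕ+), Set.InjOn g A → ∀ y, ∃ z,
      κ z = A.indicator (fun m => κ y (g m)) ∧ ‖z‖ ≤ ‖y‖) : IsSnakeSpace Y δ where
  locallyConvex := NormedSpace.toLocallyConvexSpace' ℂ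
  isFSpace := IsFSpace.of_completeSpace Y
  exists_embed := by
    have hs : ∀ x : RapidlyDecreasing, Summable fun j => ‖x.1 j • δ j‖ := fun x =>
      (x.2 0).of_nonneg_of_le (fun j => norm_nonneg _) fun j => by
        rw [norm_smul, pow_zero]
        exact mul_le_mul_of_nonneg_left (hδ j) (norm_nonneg _)
    let L : RapidlyDecreasing →ₗ[ℂ] Y :=
      { toFun := fun x => ∑' j, x.1 j • δ j
        map_add' := fun x y => by
          rw [← (hs x).of_norm.tsum_add (hs y).of_norm]
          exact tsum_congr fun j => add_smul _ _ _
        map_smul' := fun a x => by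
          rw [RingHom.id_apply, ← (hs x).of_norm.tsum_const_smul]
          exact tsum_congr fun j => mul_smul _ _ _ }
    refine ⟨⟨L, ?_⟩, fun j => ?_⟩
    · refine RapidlyDecreasing.withSeminorms.continuous_of_isBounded (norm_withSeminorms ℂ Y) L
        fun _ => ⟨{0}, 1, fun x => ?_⟩
      rw [Finset.sup_singleton, one_smul]
      refine (norm_tsum_le_tsum_norm (hs x)).trans ((hs x).tsum_le_tsum (fun j => ?_) (x.2 0))
      rw [norm_smul, pow_zero]
      exact mul_le_mul_of_nonneg_left (hδ j) (norm_nonneg _)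
    · refine (tsum_eq_single j fun n hn => ?_).trans ?_
      · simp [hn]
      · simp
  dense_span := hdense
  exists_coords := by
    refine ⟨κ, hinj, hκ, fun A g _ hg _ => ?_⟩
    choose R hR hn using hR A g hg
    refine ⟨LinearMap.mkContinuous
      { toFun := R
        map_add' := fun x y => hinj ?_
        map_smul' := fun a x => hinj ?_ } 1 fun y => by simpa using hn y, hR⟩
    · funext n
      by_cases h : n ∈ A <;> simp [hR, h]
    · funext n
      by_cases h : n ∈ A <;> simp [hR, h]

theorem isSnakeSpace_lp (p : ℝ≥0∞) [Fact (1 ≤ p)] (hp : p ≠ ⊤) :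
    IsSnakeSpace (lp (fun _ : ℕ+ => ℂ) p) (fun j => lp.single p j 1) := by
  have hp0 : 0 < p.toReal := ENNReal.toReal_pos (one_pos.trans_le Fact.out).ne' hp
  refine IsSnakeSpace.of_banach (fun j => ?_) (fun x => ?_)
    ({ toFun := fun x => x, map_add' := fun _ _ => rfl, map_smul' := fun _ _ => rfl })
    (fun x y h => lp.ext h) (fun j => rfl) fun A g hg y => ?_
  · rw [lp.norm_single (one_pos.trans_le Fact.out), norm_one]
  · refine mem_closure_of_tendsto (lp.hasSum_single hp x) (Eventually.of_forall fun F => ?_)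
    refine Submodule.sum_mem _ fun j _ => ?_
    have : lp.single p j (x j) = x j • lp.single (E := fun _ : ℕ+ => ℂ) p j 1 := by
      rw [← lp.single_smul, smul_eq_mul, mul_one]
    rw [this]
    exact Submodule.smul_mem _ _ (Submodule.subset_span ⟨j, rfl⟩)
  · have hsum : ∀ F : Finset ℕ+, ∑ m ∈ F, ‖A.indicator (fun m => y (g m)) m‖ ^ p.toReal ≤
        ‖y‖ ^ p.toReal := by
      intro F
      classical
      have h0 : ∀ m ∈ F, m ∉ F.filter (· ∈ A) →
          ‖A.indicator (fun m => y (g m)) m‖ ^ p.toReal = 0 := fun m hm hm' => by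
        rw [Set.indicator_of_notMem fun h => hm' (Finset.mem_filter.2 ⟨hm, h⟩), norm_zero,
          Real.zero_rpow hp0.ne']
      rw [← Finset.sum_subset (Finset.filter_subset _ _) h0]
      calc _ = ∑ m ∈ F.filter (· ∈ A), ‖y (g m)‖ ^ p.toReal :=
            Finset.sum_congr rfl fun m hm => by
              rw [Set.indicator_of_mem (Finset.mem_filter.1 hm).2]
        _ = ∑ j ∈ (F.filter (· ∈ A)).image g, ‖y j‖ ^ p.toReal := by
            rw [Finset.sum_image]
            exact fun a ha b hb h => hg (Finset.mem_filter.1 ha).2 (Finset.mem_filter.1 hb).2 h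
        _ ≤ _ := lp.sum_rpow_le_norm_rpow hp0 y _
    exact ⟨⟨A.indicator fun m => y (g m), memℓp_gen' hsum⟩, rfl,
      lp.norm_le_of_forall_sum_le hp0 (norm_nonneg _) hsum⟩

theorem isSnakeSpace_c0 : IsSnakeSpace C₀(ℕ+, ℂ) c0Unit := by
  have hnorm : ∀ (x : C₀(ℕ+, ℂ)) (C : ℝ), 0 ≤ C → (∀ n, ‖x n‖ ≤ C) → ‖x‖ ≤ C := fun x C hC h =>
    (BoundedContinuousFunction.norm_le hC).2 h
  have hle : ∀ (x : C₀(ℕ+, ℂ)) n, ‖x n‖ ≤ ‖x‖ := fun x n =>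
    BoundedContinuousFunction.norm_coe_le_norm x.toBCF n
  have hunit : ∀ j n, c0Unit j n = (Pi.single j 1 : ℕ+ → ℂ) n := fun _ _ => rfl
  refine IsSnakeSpace.of_banach (fun j => hnorm _ _ zero_le_one fun n => ?_) (fun x => ?_)
    ({ toFun := fun x => x, map_add' := fun _ _ => rfl, map_smul' := fun _ _ => rfl })
    DFunLike.coe_injective (fun j => rfl) fun A g hg y => ?_
  · rw [hunit, Pi.single_apply]
    split_ifs <;> simp
  · refine Metric.mem_closure_iff.2 fun ε hε => ?_
    have h1 : ∀ᶠ n in cofinite, ‖x n‖ < ε / 2 := by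
      have := x.zero_at_infty'
      rw [cocompact_eq_cofinite] at this
      exact this.norm.eventually (gt_mem_nhds (by simpa using half_pos hε))
    have hfin : {n | ¬ ‖x n‖ < ε / 2}.Finite := h1
    refine ⟨∑ j ∈ hfin.toFinset, x j • c0Unit j, Submodule.sum_mem _ fun j _ =>
      Submodule.smul_mem _ _ (Submodule.subset_span ⟨j, rfl⟩), ?_⟩
    rw [dist_eq_norm]
    refine (hnorm _ _ (half_pos hε).le fun n => ?_).trans_lt (half_lt_self hε)
    have h2 : (∑ j ∈ hfin.toFinset, x j • c0Unit j) n = if n ∈ hfin.toFinset then x n else 0 := by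
      have h3 : ∀ F : Finset ℕ+, (∑ j ∈ F, x j • c0Unit j) n = ∑ j ∈ F, x j * c0Unit j n := by
        intro F
        induction F using Finset.induction_on with
        | empty => rfl
        | insert a F ha ih =>
          rw [Finset.sum_insert ha, Finset.sum_insert ha, ← ih]
          rfl
      rw [h3]
      simp [hunit, Pi.single_apply]
    rw [ZeroAtInftyContinuousMap.sub_apply, h2]
    split_ifs with h
    · rw [sub_self, norm_zero]; exact (half_pos hε).le
    · rw [sub_zero]
      have : ‖x n‖ < ε / 2 := by simpa using h
      exact this.le
  · have hz : Tendsto (A.indicator fun m => y (g m)) (cocompact ℕ+) (𝓝 0) := by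
      rw [cocompact_eq_cofinite]
      have hy := y.zero_at_infty'
      rw [cocompact_eq_cofinite] at hy
      refine Metric.tendsto_nhds.2 fun ε hε => ?_
      have h1 : {n | ¬ dist (y n) 0 < ε}.Finite := Metric.tendsto_nhds.1 hy ε hε
      -- Injectivity on A pulls the finite exceptional set of y back to a finite set.
      have h2 : (A ∩ g ⁻¹' {n | ¬ dist (y n) 0 < ε}).Finite :=
        Set.Finite.of_finite_image (f := g) (h1.subset (by rintro _ ⟨m, hm, rfl⟩; exact hm.2))
          (hg.mono Set.inter_subset_left)
      refine h2.subset fun m hm => ?_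
      by_cases hA : m ∈ A
      · refine ⟨hA, fun h => hm ?_⟩
        change dist (A.indicator (fun m => y (g m)) m) 0 < ε
        rwa [Set.indicator_of_mem hA]
      · refine absurd ?_ hm
        change dist (A.indicator (fun m => y (g m)) m) 0 < ε
        rwa [Set.indicator_of_notMem hA, dist_self]
    refine ⟨⟨⟨A.indicator fun m => y (g m), continuous_of_discreteTopology⟩, hz⟩, rfl,
      hnorm _ _ (norm_nonneg _) fun n => ?_⟩
    change ‖A.indicator (fun m => y (g m)) n‖ ≤ ‖y‖
    by_cases hA : n ∈ A
    · rw [Set.indicator_of_mem hA]; exact hle y _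
    · rw [Set.indicator_of_notMem hA, norm_zero]; exact norm_nonneg _

end

theorem mainTheorem4 :
    ∃ f : {q : ℕ+ × ℕ+ // q ≠ (1, 1)} ≃ ℕ+ × ℕ+, ∀ lam : ℝ, 1 < lam →
      (∀ (p : ℝ≥0∞) [Fact (1 ≤ p)], p ≠ ⊤ →
        SnakeShiftProperty (lp (fun _ : ℕ+ => ℂ) p) (fun j => lp.single p j 1) f lam) ∧
      SnakeShiftProperty C₀(ℕ+, ℂ) c0Unit f lam ∧
      SnakeShiftProperty RapidlyDecreasing RapidlyDecreasing.unit f lam := by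
  refine ⟨Snake.back, fun lam hlam => ⟨fun p _ hp => ?_, ?_, ?_⟩⟩
  · exact (isSnakeSpace_lp p hp).snakeShiftProperty hlam
  · exact isSnakeSpace_c0.snakeShiftProperty hlam
  · exact RapidlyDecreasing.isSnakeSpace.snakeShiftProperty hlam
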